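/- Let $\mathrm{Diffeo}^+(\mathbb R^2)$ be the (discrete) group of orientation-preserving $C^\infty$ diffeomorphisms of the plane. Its Euler class $[e]\in H^2(\mathrm{Diffeo}^+(\mathbb R^2);\mathbb Z)$ is the class of the central extension $$0\to\mathbb Z\to\widehat G\to\mathrm{Diffeo}^+(\mathbb R^2)\to 1,$$ where $\widehat G$ is the group of pairs $(g,\tilde g)$ with $g\in\mathrm{Diffeo}^+(\mathbb R^2)$ and $\tilde g$ a lift of the germ of $g$ at $\infty$ to a periodic germ (one commuting with the deck transformations) of homeomorphisms of the universal cover of a punctured disk neighbourhood of $\infty$, and $\mathbb Z$ is the group of deck transformations. Let $S$ be the closed orientable surface of genus $2$, let $\pi_1(S)=\langle a_1,b_1,a_2,b_2\mid [a_1,b_1][a_2,b_2]\rangle$, and let $[S]\in H_2(\pi_1(S);\mathbb Z)=H_2(S;\mathbb Z)$ be its fundamental class. Then for each integer $i$ there is a homomorphism ($C^\infty$ action) $\rho_i:\pi_1(S)\to\mathrm{Diffeo}^+(\mathbb R^2)$ with $$\rho_i^*([e])([S])=i.$$ In particular, the Euler class $[e]\in H^2(\mathrm{Diffeo}^+(\mathbb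 R^2);\mathbb Z)$ is unbounded: its image in $H^2(\mathrm{Diffeo}^+(\mathbb R^2);\mathbb R)$ is not represented by any bounded cocycle. -/

import Mathlib

noncomputable section

namespace PlanarEuler

open Filter Topology
open scoped ContDiff Real commutatorElement

/-! ## The group of orientation-preserving smooth diffeomorphisms of the plane

The plane `ℝ²` is modelled by `ℂ`, regarded as a two-dimensional real vector space. -/

/-- `Diffeo⁺(ℝ²)`: bijections of the plane that are `C^∞` (in the real sense) together with their
inverse and whose real derivative has positive determinant everywhere. The group law is
composition; the group is considered without topology (as a discrete group). -/
def DiffeoPlus : Subgroup (Equiv.Perm ℂ) where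
  carrier := {f | ContDiff ℝ ∞ f ∧ ContDiff ℝ ∞ f.symm ∧ ∀ z, 0 < (fderiv ℝ f z).det}
  one_mem' := by
    refine ⟨contDiff_id, contDiff_id, fun z => ?_⟩
    have : fderiv ℝ (⇑(1 : Equiv.Perm ℂ)) z = ContinuousLinearMap.id ℝ ℂ := fderiv_id
    rw [this]; simp [ContinuousLinearMap.det]
  mul_mem' := by
    rintro f g ⟨hf, hf', hfd⟩ ⟨hg, hg', hgd⟩
    refine ⟨hf.comp hg, hg'.comp hf', fun z => ?_⟩
    have h : fderiv ℝ (⇑(f * g)) z = (fderiv ℝ f (g z)).comp (fderiv ℝ g z) :=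
      fderiv_comp z (hf.differentiable (by simp) _) (hg.differentiable (by simp) _)
    rw [h]
    have := mul_pos (hfd (g z)) (hgd z)
    rwa [ContinuousLinearMap.det, ContinuousLinearMap.det, ← LinearMap.det_comp] at this
  inv_mem' := by
    rintro f ⟨hf, hf', hfd⟩
    refine ⟨hf', hf, fun z => ?_⟩
    have h : (fderiv ℝ f (f.symm z)).comp (fderiv ℝ f.symm z) = ContinuousLinearMap.id ℝ ℂ := by
      rw [← fderiv_comp z (hf.differentiable (by simp) _) (hf'.differentiable (by simp) _)]
      have : (⇑f ∘ ⇑f.symm) = id := by ext; simp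
      rw [this]; exact fderiv_id
    have h1 : (fderiv ℝ f (f.symm z)).det * (fderiv ℝ f.symm z).det = 1 := by
      rw [ContinuousLinearMap.det, ContinuousLinearMap.det, ← LinearMap.det_comp,
        ← ContinuousLinearMap.toLinearMap_comp, h]; simp
    have h2 := hfd (f.symm z)
    show 0 < (fderiv ℝ f.symm z).det
    by_contra h3
    nlinarith

/-! ## Germs at infinity on the universal cover of a punctured neighbourhood of infinity

For `R : ℝ`, `exp : {w | R < re w} → {z | e ^ R < |z|}` is a universal covering of a punctured disk
neighbourhood of the point at infinity of the plane; its deck group is generated by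
`w ↦ w + 2πi`. -/

/-- The neighbourhoods of the end of the universal cover: generated by the half planes
`{w | R < re w}`. -/
def endFilter : Filter ℂ := comap Complex.re atTop

/-- Representatives of germs of continuous self-maps of the universal cover at its end: maps that
are continuous on some half plane `{w | R < re w}` and preserve the end. -/
@[ext]
structure EndMap where
  toFun : ℂ → ℂ
  continuousOn : ∃ R : ℝ, ContinuousOn toFun {w | R < w.re}
  tendsto : Tendsto toFun endFilter endFilter

instance : CoeFun EndMap (fun _ => ℂ → ℂ) := ⟨EndMap.toFun⟩

/-- Composition. -/
def EndMap.comp (F H : EndMap) : EndMap where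
  toFun := F ∘ H
  continuousOn := by
    obtain ⟨R, hR⟩ := F.continuousOn
    obtain ⟨S, hS⟩ := H.continuousOn
    have h1 : ∀ᶠ w in endFilter, R < (H w).re :=
      H.tendsto.eventually (tendsto_comap.eventually (eventually_gt_atTop R))
    rw [endFilter, eventually_comap, eventually_atTop] at h1
    obtain ⟨T, hT⟩ := h1
    refine ⟨max S T, hR.comp (hS.mono fun w hw => ?_) fun w hw => ?_⟩
    · exact lt_of_le_of_lt (le_max_left S T) hw
    · exact hT _ (lt_of_le_of_lt (le_max_right S T) hw).le w rfl
  tendsto := F.tendsto.comp H.tendsto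

instance : Monoid EndMap where
  mul := EndMap.comp
  one := ⟨id, ⟨0, continuousOn_id⟩, tendsto_id⟩
  mul_assoc _ _ _ := rfl
  one_mul _ := rfl
  mul_one _ := rfl

lemma EndMap.mul_apply (F H : EndMap) (w : ℂ) : (F * H) w = F (H w) := rfl

lemma EndMap.one_apply (w : ℂ) : (1 : EndMap) w = w := rfl

/-- Two representatives have the same germ if they agree on some half plane `{w | R < re w}`. -/
def germCon : Con EndMap where
  r F H := F =ᶠ[endFilter] H
  iseqv := ⟨fun _ => EventuallyEq.rfl, fun h => h.symm, fun h h' => h.trans h'⟩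
  mul' := by
    intro F F' H H' h h'
    have h1 : F ∘ H =ᶠ[endFilter] F' ∘ H := H.tendsto.eventually h
    exact h1.trans (h'.fun_comp _)

/-- The monoid of germs of continuous self-maps of the universal cover at its end. Its group of
units `EndGermsˣ` is the group of germs of homeomorphisms. -/
abbrev EndGerms : Type := germCon.Quotient

/-- The deck transformation `w ↦ w + 2πi n`. -/
def deckMap (n : ℤ) : EndMap where
  toFun w := w + n * (2 * π * Complex.I)
  continuousOn := ⟨0, by fun_prop⟩
  tendsto := by
    rw [endFilter, tendsto_comap_iff]
    have : (Complex.re ∘ fun w : ℂ => w + n * (2 * π * Complex.I)) = Complex.re := by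
      funext w; simp
    rw [this]; exact tendsto_comap

/-- The germs of the deck transformations, as a homomorphism from `ℤ`; `1` is sent to the germ of
`w ↦ w + 2πi`. -/
def deck : Multiplicative ℤ →* EndGermsˣ :=
  MonoidHom.toHomUnits
    { toFun := fun n => (deckMap n.toAdd : EndGerms)
      map_one' := by
        rw [← Con.coe_one]; congr 1
        ext w; simp [deckMap, EndMap.one_apply]
      map_mul' := fun m n => by
        rw [← Con.coe_mul]; congr 1
        ext w
        simp only [deckMap, EndMap.mul_apply, toAdd_mul]
        push_cast; ring }

lemma deck_val (n : Multiplicative ℤ) : (deck n : EndGerms) = (deckMap n.toAdd : EndGerms) := rfl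

/-- The germ `φ` is a lift to the universal cover of the germ of `g` at infinity:
`exp (φ w) = g (exp w)` for `re w` large. -/
def Covers (g : Equiv.Perm ℂ) (φ : EndGerms) : Prop :=
  ∃ F : EndMap, (F : EndGerms) = φ ∧
    ∀ᶠ w in endFilter, Complex.exp (F w) = g (Complex.exp w)

lemma covers_mk {g : Equiv.Perm ℂ} {F : EndMap} : Covers g (F : EndGerms) ↔
    ∀ᶠ w in endFilter, Complex.exp (F w) = g (Complex.exp w) := by
  constructor
  · rintro ⟨H, hH, h⟩
    have h1 : H =ᶠ[endFilter] F := (Con.eq germCon).1 hH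
    filter_upwards [h, h1] with w hw h1w
    rw [← hw, h1w]
  · exact fun h => ⟨F, rfl, h⟩

lemma Covers.one : Covers 1 1 := ⟨1, rfl, Eventually.of_forall fun _ => rfl⟩

lemma Covers.mul {g h : Equiv.Perm ℂ} {φ ψ : EndGerms} (hφ : Covers g φ) (hψ : Covers h ψ) :
    Covers (g * h) (φ * ψ) := by
  obtain ⟨F, rfl, hF⟩ := hφ
  obtain ⟨H, rfl, hH⟩ := hψ
  refine ⟨F * H, rfl, ?_⟩
  filter_upwards [H.tendsto.eventually hF, hH] with w h1 h2
  show Complex.exp (F (H w)) = g (h (Complex.exp w))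
  rw [h1, h2]

lemma Covers.inv {g : Equiv.Perm ℂ} {φ : EndGermsˣ} (hφ : Covers g (φ : EndGerms)) :
    Covers g⁻¹ ((φ⁻¹ : EndGermsˣ) : EndGerms) := by
  obtain ⟨F, hF', hF⟩ := hφ
  obtain ⟨H, hH⟩ := Con.mk'_surjective (c := germCon) ((φ⁻¹ : EndGermsˣ) : EndGerms)
  have hH : (H : EndGerms) = _ := hH
  have h1 : ((F * H : EndMap) : EndGerms) = ((1 : EndMap) : EndGerms) := by
    rw [Con.coe_mul, hF', hH, Units.mul_inv]; rfl
  have h1 : (F * H : EndMap) =ᶠ[endFilter] (1 : EndMap) :=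
    (Con.eq germCon).1 h1
  refine ⟨H, hH, ?_⟩
  filter_upwards [h1, H.tendsto.eventually hF] with w h2 h3
  have h2 : F (H w) = w := h2
  rw [h2] at h3
  rw [h3]; simp

/-! ### Auxiliary facts: every orientation-preserving diffeomorphism has a periodic lift -/

/-- A continuous map with values in `2πiℤ` on a preconnected set is constant. -/
lemma const_of_exp_eq_one {X : Type*} [TopologicalSpace X] {s : Set X} (hs : IsPreconnected s)
    {f : X → ℂ} (hf : ContinuousOn f s) (h : ∀ x ∈ s, Complex.exp (f x) = 1) :
    ∀ x ∈ s, ∀ y ∈ s, f x = f y := by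
  intro x hx y hy
  have hn : (2 * π * Complex.I : ℂ) ≠ 0 := by simp [Real.pi_ne_zero]
  have key : ∀ z ∈ s, ∃ n : ℤ, f z = n * (2 * π * Complex.I) := fun z hz =>
    Complex.exp_eq_one_iff.1 (h z hz)
  choose! n hn' using key
  have hc : ContinuousOn (fun z => (n z : ℝ)) s := by
    have : ContinuousOn (fun z => (f z).im / (2 * π)) s :=
      (Complex.continuous_im.comp_continuousOn hf).div_const _
    refine this.congr fun z hz => ?_
    simp only
    rw [hn' z hz]
    simp
  have hc' : ContinuousOn n s := by
    have hi : IsEmbedding (fun m : ℤ => (m : ℝ)) := Int.isClosedEmbedding_coe_real.isEmbedding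
    exact (hi.continuousOn_iff).2 hc
  have := hs.constant hc' hx hy
  rw [hn' x hx, hn' y hy, this]

/-- The family `(g(tz) - g(0)) / t` (and `Dg(0)z` at `t = 0`), written as `∫₀¹ Dg(stz) z ds`. -/
def fam (g : ℂ → ℂ) (t : ℝ) (z : ℂ) : ℂ := ∫ s in (0:ℝ)..1, fderiv ℝ g ((s * t : ℝ) • z) z

lemma continuous_fam {g : ℂ → ℂ} (hg : ContDiff ℝ 1 g) :
    Continuous fun p : ℝ × ℂ => fam g p.1 p.2 := by
  unfold fam
  apply intervalIntegral.continuous_parametric_intervalIntegral_of_continuous'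
  have := hg.continuous_fderiv (by simp)
  unfold Function.uncurry
  fun_prop

lemma smul_fam {g : ℂ → ℂ} (hg : ContDiff ℝ 1 g) (t : ℝ) (z : ℂ) :
    t • fam g t z = g (t • z) - g 0 := by
  unfold fam
  rw [← intervalIntegral.integral_smul]
  have h : ∀ s : ℝ, HasDerivAt (fun s : ℝ => g ((s * t) • z))
      (t • fderiv ℝ g ((s * t : ℝ) • z) z) s := by
    intro s
    have h1 := (hg.differentiable (by simp) ((s * t) • z)).hasFDerivAt
    have h2 : HasDerivAt (fun s : ℝ => (s * t) • z) (t • z) s := by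
      simpa using ((hasDerivAt_id s).mul_const t).smul_const z
    have := h1.comp_hasDerivAt s h2
    have h3 : t • fderiv ℝ g ((s * t : ℝ) • z) z = fderiv ℝ g ((s * t : ℝ) • z) (t • z) := by
      rw [map_smul]
    rw [h3]
    exact this
  rw [intervalIntegral.integral_eq_sub_of_hasDerivAt (fun s _ => h s)]
  · simp
  · apply Continuous.intervalIntegrable
    have := hg.continuous_fderiv (by simp)
    fun_prop

lemma fam_zero (g : ℂ → ℂ) (z : ℂ) : fam g 0 z = fderiv ℝ g 0 z := by simp [fam]

lemma injective_of_det_pos {L : ℂ →L[ℝ] ℂ} (h : 0 < L.det) {z : ℂ} (hz : z ≠ 0) : L z ≠ 0 := by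
  have h1 : Function.Injective (L : ℂ →ₗ[ℝ] ℂ) := by
    rw [← LinearMap.ker_eq_bot]
    by_contra hne
    exact h.ne' (LinearMap.det_eq_zero_iff_ker_ne_bot.2 hne)
  intro h0
  exact hz (h1 (by simpa using h0))

lemma fam_ne_zero {g : ℂ → ℂ} (hg : ContDiff ℝ 1 g) (hi : Function.Injective g)
    (hd : 0 < (fderiv ℝ g 0).det) (t : ℝ) {z : ℂ} (hz : z ≠ 0) : fam g t z ≠ 0 := by
  rcases eq_or_ne t 0 with rfl | ht
  · rw [fam_zero]; exact injective_of_det_pos hd hz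
  · intro h
    have := smul_fam hg t z
    rw [h, smul_zero] at this
    have := hi (sub_eq_zero.1 this.symm)
    simp [ht, hz] at this

/-- Complex form of a real-linear map with positive determinant. -/
lemma exists_complex_form {L : ℂ →L[ℝ] ℂ} (h : 0 < L.det) :
    ∃ a b : ℂ, ‖b‖ < ‖a‖ ∧ ∀ z, L z = a * z + b * (starRingEnd ℂ) z := by
  set p := L 1
  set q := L Complex.I
  have hL : ∀ z, L z = z.re * p + z.im * q := by
    intro z
    conv_lhs => rw [← Complex.re_add_im z]
    have : ((z.re : ℂ) + z.im * Complex.I) = z.re • (1 : ℂ) + z.im • Complex.I := by simp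
    rw [this, map_add, map_smul, map_smul]
    simp [p, q]
  have hdet : L.det = p.re * q.im - q.re * p.im := by
    rw [ContinuousLinearMap.det, ← LinearMap.det_toMatrix Complex.basisOneI, Matrix.det_fin_two]
    simp [LinearMap.toMatrix_apply, p, q]
  refine ⟨(p - Complex.I * q) / 2, (p + Complex.I * q) / 2, ?_, fun z => ?_⟩
  · rw [norm_div, norm_div]
    gcongr
    · simp
    rw [← sq_lt_sq₀ (norm_nonneg _) (norm_nonneg _), ← Complex.normSq_eq_norm_sq,
      ← Complex.normSq_eq_norm_sq, Complex.normSq_apply, Complex.normSq_apply]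
    rw [hdet] at h
    simp
    nlinarith
  · rw [hL]
    apply Complex.ext <;> simp <;> ring

/-- Continuous logarithms on simply connected spaces. -/
lemma exists_log_lift {A : Type*} [TopologicalSpace A] [SimplyConnectedSpace A]
    [LocallyPathConnectedSpace A] (f : A → ℂ) (hf : Continuous f) (h0 : ∀ a, f a ≠ 0) :
    ∃ F : A → ℂ, Continuous F ∧ ∀ a, Complex.exp (F a) = f a := by
  obtain ⟨a₀⟩ : Nonempty A := inferInstance
  obtain ⟨F, ⟨-, hF⟩, -⟩ := Complex.isCoveringMapOn_exp.existsUnique_continuousMap_lifts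
    (⟨f, hf⟩ : C(A, ℂ)) (a₀ := a₀) (e₀ := Complex.log (f a₀)) (Complex.exp_log (h0 a₀)) h0
  exact ⟨F, F.continuous, fun a => congrFun hF a⟩

lemma tendsto_exp_endFilter : Tendsto Complex.exp endFilter (cocompact ℂ) := by
  rw [← Metric.cobounded_eq_cocompact, ← tendsto_norm_atTop_iff_cobounded]
  simp only [Complex.norm_exp]
  exact Real.tendsto_exp_atTop.comp tendsto_comap

/-- Existence of periodic lifts of `g - g(0)`. -/
lemma exists_lift_aux {g : ℂ → ℂ} (hg : ContDiff ℝ 1 g) (hi : Function.Injective g)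
    (hd : 0 < (fderiv ℝ g 0).det) :
    ∃ F : ℂ → ℂ, Continuous F ∧ (∀ w, Complex.exp (F w) = g (Complex.exp w) - g 0) ∧
      ∀ w, F (w + 2 * π * Complex.I) = F w + 2 * π * Complex.I := by
  obtain ⟨F, hFc, hF⟩ := exists_log_lift (A := ℝ × ℂ) (fun p => fam g p.1 (Complex.exp p.2))
    ((continuous_fam hg).comp (continuous_fst.prodMk (Complex.continuous_exp.comp continuous_snd)))
    (fun p => fam_ne_zero hg hi hd _ (Complex.exp_ne_zero _))
  obtain ⟨a, b, hab, hL⟩ := exists_complex_form hd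
  have ha : a ≠ 0 := norm_pos_iff.1 ((norm_nonneg b).trans_lt hab)
  -- the linear end
  let u : ℂ → ℂ := fun w => 1 + b / a * Complex.exp ((starRingEnd ℂ) w - w)
  have hu : ∀ w, u w ∈ Complex.slitPlane := by
    intro w
    apply Complex.mem_slitPlane_of_norm_lt_one
    rw [norm_mul, norm_div, Complex.norm_exp]
    simp only [Complex.sub_re, Complex.conj_re, sub_self, Real.exp_zero, mul_one]
    rwa [div_lt_one (norm_pos_iff.2 ha)]
  let K : ℂ → ℂ := fun w => w + Complex.log a + Complex.log (u w)
  have huc : Continuous u := by fun_prop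
  have hKc : Continuous K :=
    (continuous_id.add continuous_const).add (huc.clog hu)
  have hK : ∀ w, Complex.exp (K w) = fam g 0 (Complex.exp w) := by
    intro w
    simp only [K]
    rw [Complex.exp_add, Complex.exp_add, Complex.exp_log ha,
      Complex.exp_log (Complex.slitPlane_ne_zero (hu w)), fam_zero, hL, ← Complex.exp_conj]
    simp only [u]
    rw [Complex.exp_sub]
    field_simp
  have hup : ∀ w, u (w + 2 * π * Complex.I) = u w := by
    intro w
    simp only [u]
    congr 2
    rw [Complex.exp_eq_exp_iff_exists_int]
    refine ⟨-2, ?_⟩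
    simp [Complex.conj_ofNat]
    ring
  have hKp : ∀ w, K (w + 2 * π * Complex.I) = K w + 2 * π * Complex.I := by
    intro w
    simp only [K]
    rw [hup]; ring
  have h1 : ∀ w, F (0, w + 2 * π * Complex.I) = F (0, w) + 2 * π * Complex.I := by
    intro w
    have := const_of_exp_eq_one (f := fun w => F (0, w) - K w) isPreconnected_univ
      (by fun_prop) (by
        intro w _
        rw [Complex.exp_sub, hF, hK, div_self]
        exact fam_ne_zero hg hi hd _ (Complex.exp_ne_zero _)) w trivial
        (w + 2 * π * Complex.I) trivial
    simp only [hKp] at this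
    linear_combination -this
  have h2 : ∀ t w, F (t, w + 2 * π * Complex.I) = F (t, w) + 2 * π * Complex.I := by
    intro t w
    have := const_of_exp_eq_one (f := fun p : ℝ × ℂ => F (p.1, p.2 + 2 * π * Complex.I) - F p)
      isPreconnected_univ (by fun_prop) (by
        intro w _
        rw [Complex.exp_sub, hF, hF, Complex.exp_periodic, div_self]
        exact fam_ne_zero hg hi hd _ (Complex.exp_ne_zero _)) (t, w) trivial (0, w) trivial
    simp only [h1] at this
    linear_combination this
  refine ⟨fun w => F (1, w), by fun_prop, fun w => ?_, h2 1⟩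
  rw [hF]
  simpa using smul_fam hg 1 (Complex.exp w)

lemma eventually_endFilter {p : ℂ → Prop} :
    (∀ᶠ w in endFilter, p w) ↔ ∃ R : ℝ, ∀ w : ℂ, R < w.re → p w := by
  rw [endFilter, eventually_comap, eventually_atTop]
  constructor
  · rintro ⟨R, hR⟩
    exact ⟨R, fun w hw => hR _ hw.le w rfl⟩
  · rintro ⟨R, hR⟩
    refine ⟨R + 1, fun b hb w hw => hR w ?_⟩
    linarith

/-- Every orientation-preserving diffeomorphism has a lift that commutes with `w ↦ w + 2πi`. -/
lemma exists_lift (g : DiffeoPlus) : ∃ F : EndMap, Covers g (F : EndGerms) ∧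
    ∀ w, F (w + 2 * π * Complex.I) = F w + 2 * π * Complex.I := by
  obtain ⟨g, hg, hg', hd⟩ := g
  obtain ⟨F, hFc, hF, hFp⟩ := exists_lift_aux (hg.of_le (by exact_mod_cast le_top)) g.injective
    (hd 0)
  have hgt : Tendsto g (cocompact ℂ) (cocompact ℂ) :=
    (Homeomorph.mk g hg.continuous hg'.continuous).isClosedEmbedding.tendsto_cocompact
  have hge : Tendsto (fun w => ‖g (Complex.exp w)‖) endFilter atTop :=
    tendsto_norm_cocompact_atTop.comp (hgt.comp tendsto_exp_endFilter)
  have hne : ∀ w, g (Complex.exp w) - g 0 ≠ 0 := fun w h =>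
    Complex.exp_ne_zero w (g.injective (sub_eq_zero.1 h))
  let v : ℂ → ℂ := fun w => 1 + g 0 / (g (Complex.exp w) - g 0)
  have hvc : Continuous v := by
    refine continuous_const.add (continuous_const.div ?_ hne)
    exact (hg.continuous.comp Complex.continuous_exp).sub continuous_const
  obtain ⟨R, hR⟩ := eventually_endFilter.1 (hge.eventually_gt_atTop (2 * ‖g 0‖))
  have hv : ∀ w : ℂ, R < w.re → v w ∈ Complex.slitPlane := by
    intro w hw
    apply Complex.mem_slitPlane_of_norm_lt_one
    rw [norm_div, div_lt_one (norm_pos_iff.2 (hne w))]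
    have := hR w hw
    have := norm_sub_norm_le (g (Complex.exp w)) (g 0)
    linarith
  have hexp : ∀ w : ℂ, R < w.re → Complex.exp (F w + Complex.log (v w)) = g (Complex.exp w) := by
    intro w hw
    rw [Complex.exp_add, hF, Complex.exp_log (Complex.slitPlane_ne_zero (hv w hw))]
    have := hne w
    simp only [v]
    field_simp
    ring
  refine ⟨⟨fun w => F w + Complex.log (v w), ⟨R, ?_⟩, ?_⟩, ?_, ?_⟩
  · exact hFc.continuousOn.add (hvc.continuousOn.clog fun w hw => hv w hw)
  · rw [endFilter, tendsto_comap_iff]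
    have h1 : Tendsto (fun w => Real.log ‖g (Complex.exp w)‖) endFilter atTop :=
      Real.tendsto_log_atTop.comp hge
    refine h1.congr' ?_
    filter_upwards [eventually_endFilter.2 ⟨R, hexp⟩] with w hw
    rw [← hw, Complex.norm_exp, Real.log_exp]; rfl
  · exact covers_mk.2 (eventually_endFilter.2 ⟨R, hexp⟩)
  · intro w
    have : v (w + 2 * π * Complex.I) = v w := by simp only [v, Complex.exp_periodic w]
    simp only [hFp, this]
    ring

/-- The germs covering the identity are the deck transformations. -/
lemma covers_one_iff {φ : EndGerms} : Covers 1 φ ↔ ∃ n, φ = (deck n : EndGerms) := by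
  constructor
  · rintro ⟨F, rfl, hF⟩
    obtain ⟨R, hR⟩ := eventually_endFilter.1 hF
    obtain ⟨S, hS⟩ := F.continuousOn
    set T := max R S with hT
    have hpre : IsPreconnected {w : ℂ | T < w.re} := (convex_halfSpace_re_gt T).isPreconnected
    have h1 : ∀ w ∈ {w : ℂ | T < w.re}, Complex.exp (F w - w) = 1 := by
      intro w hw
      rw [Complex.exp_sub, hR w (lt_of_le_of_lt (le_max_left R S) hw)]
      exact div_self (Complex.exp_ne_zero w)
    have h2 := const_of_exp_eq_one hpre (f := fun w => F w - w)
      ((hS.mono fun w hw => lt_of_le_of_lt (le_max_right R S) hw).sub continuousOn_id) h1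
    have hb : ((T + 1 : ℝ) : ℂ) ∈ {w : ℂ | T < w.re} := by simp
    obtain ⟨n, hn⟩ := Complex.exp_eq_one_iff.1 (h1 _ hb)
    refine ⟨Multiplicative.ofAdd n, ?_⟩
    rw [deck_val, Con.eq]
    refine eventually_endFilter.2 ⟨T, fun w hw => ?_⟩
    have := h2 w hw _ hb
    rw [hn] at this
    simp only [deckMap, toAdd_ofAdd]
    linear_combination this
  · rintro ⟨n, rfl⟩
    refine covers_mk.2 (Eventually.of_forall fun w => ?_)
    exact Complex.exp_eq_exp_iff_exists_int.2 ⟨n.toAdd, rfl⟩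

lemma deck_eq_zpow (n : Multiplicative ℤ) :
    deck n = deck (Multiplicative.ofAdd 1) ^ n.toAdd := by
  rw [← map_zpow, ← ofAdd_zsmul]; simp

lemma deck_injective : Function.Injective deck := by
  rw [injective_iff_map_eq_one]
  intro n hn
  have h : (deckMap n.toAdd : EndGerms) = ((1 : EndMap) : EndGerms) := by
    rw [← deck_val, hn]; rfl
  obtain ⟨R, hR⟩ := eventually_endFilter.1 ((Con.eq germCon).1 h)
  have := hR ((R + 1 : ℝ) : ℂ) (by simp)
  simpa [deckMap, EndMap.one_apply, Real.pi_ne_zero] using this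

/-! ### The Euler extension -/

/-- The group of pairs `(g, φ)` with `g ∈ Diffeo⁺(ℝ²)` and `φ` a periodic germ of homeomorphisms of
the universal cover (periodic: commuting with `w ↦ w + 2πi`) lifting the germ of `g` at infinity.
It is the pull-back to `Diffeo⁺(ℝ²)` of the group of periodic germs along the map
sending `g` to its germ at infinity. -/
def LiftGroup : Subgroup (DiffeoPlus × EndGermsˣ) where
  carrier := {p | Covers p.1 (p.2 : EndGerms) ∧ Commute p.2 (deck (Multiplicative.ofAdd 1))}
  one_mem' := ⟨Covers.one, Commute.one_left _⟩
  mul_mem' h h' := ⟨h.1.mul h'.1, h.2.mul_left h'.2⟩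
  inv_mem' h := ⟨h.1.inv, h.2.inv_left⟩

lemma exists_mem_liftGroup (g : DiffeoPlus) : ∃ φ, (g, φ) ∈ LiftGroup := by
  obtain ⟨F, hF, hFp⟩ := exists_lift g
  obtain ⟨H, hH, -⟩ := exists_lift g⁻¹
  have h1 : Covers 1 ((F : EndGerms) * H) := by simpa using hF.mul hH
  have h2 : Covers 1 ((H : EndGerms) * F) := by simpa using hH.mul hF
  obtain ⟨m, hm⟩ := covers_one_iff.1 h1
  obtain ⟨n, hn⟩ := covers_one_iff.1 h2
  have hFu : IsUnit (F : EndGerms) := by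
    have hr : (F : EndGerms) * (H * (deck m)⁻¹ : EndGerms) = 1 := by
      rw [← mul_assoc, hm, Units.mul_inv]
    have hl : ((deck n)⁻¹ * H : EndGerms) * (F : EndGerms) = 1 := by
      rw [mul_assoc, hn, Units.inv_mul]
    have := left_inv_eq_right_inv hl hr
    exact ⟨⟨F, _, hr, this ▸ hl⟩, rfl⟩
  obtain ⟨φ, hφ⟩ := hFu
  refine ⟨φ, ?_, ?_⟩
  · show Covers g (φ : EndGerms)
    rw [hφ]; exact hF
  · refine Units.ext ?_
    rw [Units.val_mul, Units.val_mul, hφ, deck_val, ← Con.coe_mul, ← Con.coe_mul]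
    congr 1
    ext w
    simpa [EndMap.mul_apply, deckMap] using hFp w

/-- The central extension `0 → ℤ → LiftGroup → Diffeo⁺(ℝ²) → 1`; the generator `1 ∈ ℤ` is sent to
the (positive) deck transformation `w ↦ w + 2πi`. -/
def eulerExtension : GroupExtension (Multiplicative ℤ) LiftGroup DiffeoPlus where
  inl := ((MonoidHom.inr DiffeoPlus EndGermsˣ).comp deck).codRestrict LiftGroup fun n =>
    ⟨covers_one_iff.2 ⟨n, rfl⟩, by
      show Commute (deck n) _
      rw [deck_eq_zpow]; exact (Commute.refl _).zpow_left _⟩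
  rightHom := (MonoidHom.fst DiffeoPlus EndGermsˣ).comp LiftGroup.subtype
  inl_injective := fun m n h => deck_injective (congrArg (fun p => p.1.2) h)
  range_inl_eq_ker_rightHom := by
    ext ⟨⟨g, φ⟩, hg⟩
    simp only [MonoidHom.mem_range, MonoidHom.mem_ker]
    constructor
    · rintro ⟨n, hn⟩
      exact (congrArg (fun p => p.1.1) hn).symm
    · intro h
      obtain rfl : g = 1 := h
      obtain ⟨n, hn⟩ := covers_one_iff.1 hg.1
      exact ⟨n, Subtype.ext (Prod.ext rfl (Units.ext hn.symm))⟩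
  rightHom_surjective := fun g => by
    obtain ⟨φ, hφ⟩ := exists_mem_liftGroup g
    exact ⟨⟨(g, φ), hφ⟩, rfl⟩

lemma eulerExtension_central (n : Multiplicative ℤ) (x : LiftGroup) :
    Commute (eulerExtension.inl n) x := by
  refine Subtype.ext (Prod.ext ?_ ?_)
  · show 1 * x.1.1 = x.1.1 * 1
    simp
  · show deck n * x.1.2 = x.1.2 * deck n
    rw [deck_eq_zpow]
    exact (x.2.2.symm.zpow_left _)

/-! ## Second (co)homology of discrete groups with trivial coefficients -/

/-- The abelian group `A` with the trivial action of `G`. -/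
abbrev triv (G A : Type) [Group G] [AddCommGroup A] : Rep.{0} ℤ G := Rep.trivial ℤ G A

/-- `H²(G; A)`, trivial coefficients. -/
abbrev Cohomology₂ (G A : Type) [Group G] [AddCommGroup A] : Type := groupCohomology.H2 (triv G A)
/-- `H₂(G; ℤ)`, trivial coefficients. -/
abbrev Homology₂ (G : Type) [Group G] : Type := groupHomology.H2 (triv G ℤ)

section ext
variable {E G : Type} [Group E] [Group G]

/-- The function `f : G × G → ℤ` with `f(g, h) = σ(g) σ(h) σ(gh)⁻¹` for a set-theoretic section `σ`
of an extension of `G` by `ℤ`. -/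
def extCocycleFun (S : GroupExtension (Multiplicative ℤ) E G) (σ : S.Section) (p : G × G) : ℤ :=
  (Classical.choose (σ.mul_mul_mul_inv_mem_range_inl p.1 p.2)).toAdd

lemma inl_extCocycleFun (S : GroupExtension (Multiplicative ℤ) E G) (σ : S.Section) (g h : G) :
    S.inl (Multiplicative.ofAdd (extCocycleFun S σ (g, h))) = σ g * σ h * (σ (g * h))⁻¹ :=
  Classical.choose_spec (σ.mul_mul_mul_inv_mem_range_inl g h)

/-- For a central extension, this is a 2-cocycle. -/
def extCocycle (S : GroupExtension (Multiplicative ℤ) E G)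
    (hS : ∀ n x, Commute (S.inl n) x) (σ : S.Section) : groupCohomology.cocycles₂ (triv G ℤ) :=
  ⟨extCocycleFun S σ, by
    rw [groupCohomology.mem_cocycles₂_iff]
    intro g h j
    show extCocycleFun S σ (g * h, j) + extCocycleFun S σ (g, h) =
      extCocycleFun S σ (h, j) + extCocycleFun S σ (g, h * j)
    apply Multiplicative.ofAdd.injective
    apply S.inl_injective
    have e := fun a b => (inl_extCocycleFun S σ a b)
    have c := fun a b x => hS (Multiplicative.ofAdd (extCocycleFun S σ (a, b))) x
    have k : ∀ a b, σ a * σ b =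
        S.inl (Multiplicative.ofAdd (extCocycleFun S σ (a, b))) * σ (a * b) := by
      intro a b; rw [e]; group
    have h1 : σ g * σ h * σ j = σ g * (σ h * σ j) := mul_assoc _ _ _
    rw [k g h, k h j, mul_assoc, k (g * h) j, ← mul_assoc (σ g), ← (c h j (σ g)).eq,
      mul_assoc _ (σ g), k g (h * j), ← mul_assoc, ← mul_assoc, mul_assoc g h j] at h1
    rw [ofAdd_add, ofAdd_add, map_mul, map_mul, (c (g * h) j _).eq]
    exact mul_right_cancel h1⟩

/-- The class in `H²(G; ℤ)` of a central extension of `G` by `ℤ`: the class of the cocycle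
`σ(g) σ(h) σ(gh)⁻¹` of any section `σ`. -/
def extClass (S : GroupExtension (Multiplicative ℤ) E G) (hS : ∀ n x, Commute (S.inl n) x) :
    Cohomology₂ G ℤ :=
  groupCohomology.H2π _ (extCocycle S hS S.surjInvRightHom)

/-- The class of a central extension does not depend on the section. -/
lemma extClass_eq (S : GroupExtension (Multiplicative ℤ) E G) (hS : ∀ n x, Commute (S.inl n) x)
    (σ : S.Section) : extClass S hS = groupCohomology.H2π _ (extCocycle S hS σ) := by
  rw [extClass, groupCohomology.H2π_eq_iff]
  obtain ⟨b, hb⟩ : ∃ b : G → ℤ, ∀ g, S.surjInvRightHom g =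
      S.inl (Multiplicative.ofAdd (b g)) * σ g :=
    ⟨fun g => (Classical.choose (S.surjInvRightHom.exists_eq_inl_mul σ g)).toAdd,
      fun g => Classical.choose_spec (S.surjInvRightHom.exists_eq_inl_mul σ g)⟩
  refine ⟨b, funext fun ⟨g, h⟩ => ?_⟩
  show b h - b (g * h) + b g = extCocycleFun S S.surjInvRightHom (g, h) - extCocycleFun S σ (g, h)
  rw [eq_sub_iff_add_eq]
  apply Multiplicative.ofAdd.injective
  apply S.inl_injective
  rw [inl_extCocycleFun, hb g, hb h, hb (g * h), ofAdd_add, map_mul, inl_extCocycleFun, ofAdd_add,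
    ofAdd_sub, map_mul, map_div]
  have c := fun a x => (hS (Multiplicative.ofAdd (b a)) x).eq
  have cg := c g
  have ch := c h
  have cgh := c (g * h)
  generalize S.inl (Multiplicative.ofAdd (b g)) = x at *
  generalize S.inl (Multiplicative.ofAdd (b h)) = y at *
  generalize S.inl (Multiplicative.ofAdd (b (g * h))) = z at *
  have hz : ∀ t, z⁻¹ * t = t * z⁻¹ := fun t => (Commute.inv_left (cgh t)).eq
  calc y / z * x * (σ g * σ h * (σ (g * h))⁻¹)
      = y * (z⁻¹ * (x * (σ g * σ h * (σ (g * h))⁻¹))) := by rw [div_eq_mul_inv]; group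
    _ = y * (x * (σ g * σ h * (σ (g * h))⁻¹)) * z⁻¹ := by rw [hz, ← mul_assoc]
    _ = y * (x * σ g) * (σ h * (σ (g * h))⁻¹) * z⁻¹ := by group
    _ = x * σ g * y * (σ h * (σ (g * h))⁻¹) * z⁻¹ := by rw [ch]
    _ = x * σ g * (y * σ h) * (z * σ (g * h))⁻¹ := by group
end ext

/-- The coefficient homomorphism `φ`, as a morphism of trivial representations over `ρ`. -/
def coeffHom {G H A B : Type} [Group G] [Group H] [AddCommGroup A] [AddCommGroup B]
    (ρ : G →* H) (φ : A →+ B) : Rep.res ρ (triv H A) ⟶ triv G B :=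
  Rep.ofHom (LinearMap.intertwiningMap_of_isIntertwiningMap
      ((Representation.trivial ℤ H A).comp ρ) (Representation.trivial ℤ G B) φ.toIntLinearMap
      fun _ _ => rfl)

/-- The map `H²(H; A) → H²(G; B)` induced by `ρ : G → H` and `φ : A → B`. -/
def cohomologyMap {G H A B : Type} [Group G] [Group H] [AddCommGroup A] [AddCommGroup B]
    (ρ : G →* H) (φ : A →+ B) : Cohomology₂ H A →ₗ[ℤ] Cohomology₂ G B :=
  (groupCohomology.map ρ (coeffHom ρ φ) 2).hom

/-- On cocycles, the induced map is `f ↦ φ ∘ f ∘ (ρ × ρ)`. -/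
lemma cohomologyMap_mk {G H A B : Type} [Group G] [Group H] [AddCommGroup A] [AddCommGroup B]
    (ρ : G →* H) (φ : A →+ B) (f : groupCohomology.cocycles₂ (triv H A)) :
    ∃ f' : groupCohomology.cocycles₂ (triv G B),
      cohomologyMap ρ φ (groupCohomology.H2π _ f) = groupCohomology.H2π _ f' ∧
      ∀ g h, f' (g, h) = φ (f (ρ g, ρ h)) := by
  refine ⟨groupCohomology.mapCocycles₂ ρ (coeffHom ρ φ) f, ?_, ?_⟩
  · exact groupCohomology.H2π_comp_map_apply ρ (coeffHom ρ φ) f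
  · intro g h; rfl

/-- The pull-back `ρ^* : H²(H; ℤ) → H²(G; ℤ)`. -/
def pullback {G H : Type} [Group G] [Group H] (ρ : G →* H) :
    Cohomology₂ H ℤ →ₗ[ℤ] Cohomology₂ G ℤ :=
  cohomologyMap ρ (AddMonoidHom.id ℤ)

/-- The change of coefficients `H²(G; ℤ) → H²(G; ℝ)`. -/
def toReal {G : Type} [Group G] : Cohomology₂ G ℤ →ₗ[ℤ] Cohomology₂ G ℝ :=
  cohomologyMap (MonoidHom.id G) (Int.castAddHom ℝ)

/-- A class in `H²(G; ℝ)` is bounded if it is represented by a bounded cocycle, i.e. if it is in the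
image of the bounded cohomology of `G`. -/
def IsBoundedClass {G : Type} [Group G] (c : Cohomology₂ G ℝ) : Prop :=
  ∃ f : groupCohomology.cocycles₂ (triv G ℝ), groupCohomology.H2π _ f = c ∧
    ∃ C : ℝ, ∀ g h : G, |(f.1 : G × G → ℝ) (g, h)| ≤ C

section pairing
variable {G : Type} [Group G]

lemma exists_cocycle (c : Cohomology₂ G ℤ) :
    ∃ f : groupCohomology.cocycles₂ (triv G ℤ), groupCohomology.H2π _ f = c := by
  induction c using groupCohomology.H2_induction_on with
  | h f => exact ⟨f, rfl⟩

lemma exists_cycle (z : Homology₂ G) :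
    ∃ x : groupHomology.cycles₂ (triv G ℤ), groupHomology.H2π _ x = z := by
  induction z using groupHomology.H2_induction_on with
  | h x => exact ⟨x, rfl⟩

/-- The value `∑ₚ x(p) f(p)` of the 2-cochain `f` on the 2-chain `x` (inhomogeneous coordinates). -/
def evalChain (f : G × G → ℤ) (x : G × G →₀ ℤ) : ℤ := Finsupp.linearCombination ℤ f x

/-- The Kronecker pairing `H²(G; ℤ) × H₂(G; ℤ) → ℤ`: evaluate a representing cocycle on a
representing cycle. -/
def pairing (c : Cohomology₂ G ℤ) (z : Homology₂ G) : ℤ :=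
  evalChain (exists_cocycle c).choose.1 (exists_cycle z).choose.1

/-- The Kronecker pairing does not depend on the choice of representatives. -/
lemma pairing_mk (f : groupCohomology.cocycles₂ (triv G ℤ))
    (x : groupHomology.cycles₂ (triv G ℤ)) :
    pairing (groupCohomology.H2π _ f) (groupHomology.H2π _ x) = evalChain f.1 x.1 := by
  have h1 := (exists_cocycle (groupCohomology.H2π _ f)).choose_spec
  have h2 := (exists_cycle (groupHomology.H2π _ x)).choose_spec
  unfold pairing
  generalize (exists_cocycle (groupCohomology.H2π _ f)).choose = f' at *
  generalize (exists_cycle (groupHomology.H2π _ x)).choose = x' at *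
  rw [groupCohomology.H2π_eq_iff] at h1
  rw [groupHomology.H2π_eq_iff] at h2
  obtain ⟨b, hb⟩ := h1
  obtain ⟨y, hy⟩ := h2
  have e1 : evalChain f'.1 x'.1 = evalChain f.1 x'.1 := by
    have hb' : ∀ p : G × G, f'.1 p - f.1 p = b p.2 - b (p.1 * p.2) + b p.1 :=
      fun p => (congrFun hb p).symm
    have h3 : ∀ u : G × G →₀ ℤ, evalChain f'.1 u - evalChain f.1 u =
        Finsupp.linearCombination ℤ b ((groupHomology.d₂₁ (triv G ℤ)).hom u) := by
      intro u
      induction u using Finsupp.induction_linear with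
      | zero => simp [evalChain]
      | add u v hu hv =>
        rw [map_add, map_add, ← hu, ← hv]
        simp only [evalChain, map_add]; ring
      | single p n =>
        rw [groupHomology.d₂₁_single (A := triv G ℤ)]
        simp only [evalChain, map_add, map_sub]
        erw [Finsupp.linearCombination_single, Finsupp.linearCombination_single,
          Finsupp.linearCombination_single, Finsupp.linearCombination_single,
          Finsupp.linearCombination_single]
        rw [← smul_sub, hb', smul_add, smul_sub]
        rfl
    have h4 := h3 x'.1
    have h5 : (groupHomology.d₂₁ (triv G ℤ)).hom x'.1 = 0 := x'.2
    rw [h5, map_zero] at h4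
    exact sub_eq_zero.1 h4
  have e2 : evalChain f.1 x'.1 = evalChain f.1 x.1 := by
    have hf := (groupCohomology.mem_cocycles₂_def f.1).1 f.2
    have h3 : ∀ u : G × G × G →₀ ℤ,
        Finsupp.linearCombination ℤ f.1 ((groupHomology.d₃₂ (triv G ℤ)).hom u) = 0 := by
      intro u
      induction u using Finsupp.induction_linear with
      | zero => simp
      | add u v hu hv => rw [map_add, map_add, hu, hv, add_zero]
      | single p n =>
        rw [groupHomology.d₃₂_single (A := triv G ℤ)]
        simp only [map_add, map_sub]
        erw [Finsupp.linearCombination_single, Finsupp.linearCombination_single,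
          Finsupp.linearCombination_single, Finsupp.linearCombination_single]
        have h6 : f.1 (p.2.1, p.2.2) - f.1 (p.1 * p.2.1, p.2.2) + f.1 (p.1, p.2.1 * p.2.2) -
          f.1 (p.1, p.2.1) = 0 := hf p.1 p.2.1 p.2.2
        have h7 : n • (f.1 (p.2.1, p.2.2) - f.1 (p.1 * p.2.1, p.2.2) +
          f.1 (p.1, p.2.1 * p.2.2) - f.1 (p.1, p.2.1)) = 0 := by rw [h6, smul_zero]
        rw [smul_sub, smul_add, smul_sub] at h7
        exact h7
    have h4 := h3 y
    rw [hy, map_sub] at h4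
    exact sub_eq_zero.1 h4
  rw [e1, e2]

end pairing

/-! ## The genus 2 surface group -/

/-- The relator `[a₁, b₁] [a₂, b₂]`, with `[a, b] = a b a⁻¹ b⁻¹`. -/
def surfaceRel : FreeGroup (Fin 4) :=
  ⁅FreeGroup.of (0 : Fin 4), FreeGroup.of (1 : Fin 4)⁆ *
    ⁅FreeGroup.of (2 : Fin 4), FreeGroup.of (3 : Fin 4)⁆

/-- `π₁(S)`, for `S` the closed orientable surface of genus 2:
`⟨a₁, b₁, a₂, b₂ | [a₁, b₁] [a₂, b₂]⟩`. -/
abbrev SurfaceGroup : Type := PresentedGroup {surfaceRel}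

namespace SurfaceGroup

/-- The generator `a₁`. -/
def a₁ : SurfaceGroup := PresentedGroup.of 0
/-- The generator `b₁`. -/
def b₁ : SurfaceGroup := PresentedGroup.of 1
/-- The generator `a₂`. -/
def a₂ : SurfaceGroup := PresentedGroup.of 2
/-- The generator `b₂`. -/
def b₂ : SurfaceGroup := PresentedGroup.of 3

lemma relation : ⁅a₁, b₁⁆ * ⁅a₂, b₂⁆ = 1 :=
  PresentedGroup.one_of_mem (rels := {surfaceRel}) (x := surfaceRel) rfl

open Finsupp in
/-- The standard fundamental cycle of the surface in the bar complex of its fundamental group. With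
`I₀ = 1`, `I₁ = [a₁, b₁]` and `I₂ = [a₁, b₁] [a₂, b₂]` it is the sum over `i = 1, 2` of
`[Iᵢ₋₁ | aᵢ] + [Iᵢ₋₁ aᵢ | bᵢ] - [Iᵢ₋₁ aᵢ bᵢ aᵢ⁻¹ | aᵢ] - [Iᵢ | bᵢ]`. -/
def fundamentalChain : SurfaceGroup × SurfaceGroup →₀ ℤ :=
  single (1, a₁) 1 + single (a₁, b₁) 1
    - single (a₁ * b₁ * a₁⁻¹, a₁) 1 - single (⁅a₁, b₁⁆, b₁) 1
    + single (⁅a₁, b₁⁆, a₂) 1 + single (⁅a₁, b₁⁆ * a₂, b₂) 1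
    - single (⁅a₁, b₁⁆ * a₂ * b₂ * a₂⁻¹, a₂) 1 - single (⁅a₁, b₁⁆ * ⁅a₂, b₂⁆, b₂) 1

lemma fundamentalChain_mem : fundamentalChain ∈ groupHomology.cycles₂ (triv SurfaceGroup ℤ) := by
  let D : (SurfaceGroup × SurfaceGroup →₀ ℤ) →ₗ[ℤ] (SurfaceGroup →₀ ℤ) :=
    (groupHomology.d₂₁ (triv SurfaceGroup ℤ)).hom
  have hD : ∀ g h, D (Finsupp.single (g, h) 1) =
      Finsupp.single h 1 - Finsupp.single (g * h) 1 + Finsupp.single g 1 :=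
    fun g h => groupHomology.d₂₁_single (A := triv SurfaceGroup ℤ) (g, h) (1 : ℤ)
  show D fundamentalChain = 0
  unfold fundamentalChain
  rw [map_sub, map_sub, map_add, map_add, map_sub, map_sub, map_add]
  simp only [hD]
  have h1 : a₁ * b₁ * a₁⁻¹ * a₁ = a₁ * b₁ := by group
  have h2 : ⁅a₁, b₁⁆ * b₁ = a₁ * b₁ * a₁⁻¹ := by rw [commutatorElement_def]; group
  have h3 : ⁅a₁, b₁⁆ * a₂ * b₂ * a₂⁻¹ * a₂ = ⁅a₁, b₁⁆ * a₂ * b₂ := by group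
  have h4 : ⁅a₁, b₁⁆ * ⁅a₂, b₂⁆ * b₂ = ⁅a₁, b₁⁆ * a₂ * b₂ * a₂⁻¹ := by
    rw [commutatorElement_def a₂]; group
  rw [h1, h2, h3, h4, relation, one_mul]
  abel

/-- The fundamental class `[S] ∈ H₂(π₁(S); ℤ) = H₂(S; ℤ)`. -/
def fundamentalClass : Homology₂ SurfaceGroup :=
  groupHomology.H2π _ ⟨fundamentalChain, fundamentalChain_mem⟩

end SurfaceGroup

/-- The Euler class `[e] ∈ H²(Diffeo⁺(ℝ²); ℤ)`: the class of the central extension given by the lifts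
of germs at infinity to the universal cover of a punctured neighbourhood of infinity. -/
def eulerClass : Cohomology₂ DiffeoPlus ℤ :=
  extClass eulerExtension eulerExtension_central

end PlanarEuler

end

noncomputable section

namespace PlanarEuler

open Filter Topology
open scoped ContDiff Real commutatorElement

/-! ## Evaluation on the fundamental cycle -/

/-! For a central extension by ℤ, the class evaluated on a genus 2 surface mapped in by `a, b, c, d`
is the integer `⁅ã, b̃⁆ * ⁅c̃, d̃⁆`, for any lifts of the four elements (`inl_surfaceSum`,
`commutator_section`). So for each `n` it is enough to find four diffeomorphisms satisfying the
surface relation whose lifted relator is the `n`-th deck transformation.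

First handle: let `a` be `z ↦ 2z` and let `b` rotate each circle about 0 by an angle that is
logarithmic in the radius, tuned so that doubling the radius changes it by `2πn`. Near infinity `a`
and `b` commute, yet their lifts, a shift by `log 2` and a shear, have commutator `deck n`
(`commutator_shiftUnit_rotationUnit`).

Second handle: `k = ⁅a, b⁆⁻¹` is supported in a disc, and it is a commutator by an infinite swindle.
The product `s` of the translates of `k` by `0, 10, 20, …`, divided by its own translate by 10,
leaves only `k`; hence `k = ⁅s, translation 10⁆` (`commutator_spread`). Both `s` and the translation
preserve the end of the negative real axis, so they have lifts preserving a line above it. The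
commutator of these lifts is a deck transformation preserving that line, hence trivial
(`commutator_eq_one_of_preservesRay`). The Euler number is therefore `n + 0`.

Unboundedness follows: a real cocycle bounded by `C` is at most `8 * C` on the eight-term
fundamental cycle, and coboundaries vanish there, whereas the Euler number takes every integer
value. -/

/-- The value of the 2-cochain `u` on the standard fundamental cycle of a genus 2 surface mapped to
`G` by sending the standard generators to `a, b, c, d`. -/
def surfaceSum {G A : Type} [Group G] [AddCommGroup A] (u : G × G → A) (a b c d : G) : A :=
  u (1, a) + u (a, b) - u (a * b * a⁻¹, a) - u (⁅a, b⁆, b) + u (⁅a, b⁆, c) + u (⁅a, b⁆ * c, d)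
    - u (⁅a, b⁆ * c * d * c⁻¹, c) - u (⁅a, b⁆ * ⁅c, d⁆, d)

open SurfaceGroup in
lemma evalChain_fundamentalChain (u : SurfaceGroup × SurfaceGroup → ℤ) :
    evalChain u fundamentalChain = surfaceSum u a₁ b₁ a₂ b₂ := by
  simp only [evalChain, fundamentalChain, map_add, map_sub, Finsupp.linearCombination_single,
    one_smul, surfaceSum]

open SurfaceGroup in
lemma pairing_pullback {G : Type} [Group G] (ρ : SurfaceGroup →* G)
    (f : groupCohomology.cocycles₂ (triv G ℤ)) :
    pairing (pullback ρ (groupCohomology.H2π _ f)) fundamentalClass =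
      surfaceSum (f.1 : G × G → ℤ) (ρ a₁) (ρ b₁) (ρ a₂) (ρ b₂) := by
  obtain ⟨f', h1, h2⟩ := cohomologyMap_mk ρ (AddMonoidHom.id ℤ) f
  rw [pullback, h1, fundamentalClass, pairing_mk, evalChain_fundamentalChain]
  have h3 : ∀ g h, (f'.1 : _ → ℤ) (g, h) = (f.1 : G × G → ℤ) (ρ g, ρ h) := h2
  simp only [surfaceSum, h3, map_mul, map_inv, map_one, map_commutatorElement]

/-- The terms telescope along the boundary word of the octagon. The surface relation closes the word
up: the value of `v` at the full relator cancels `v 1` from the first term. -/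
lemma surfaceSum_coboundary {G A : Type} [Group G] [AddCommGroup A] (v : G → A) {a b c d : G}
    (h : ⁅a, b⁆ * ⁅c, d⁆ = 1) :
    surfaceSum (fun p => v p.2 - v (p.1 * p.2) + v p.1) a b c d = 0 := by
  have h1 : a * b * a⁻¹ * a = a * b := by group
  have h2 : ⁅a, b⁆ * b = a * b * a⁻¹ := by rw [commutatorElement_def]; group
  have h3 : ⁅a, b⁆ * c * d * c⁻¹ * c = ⁅a, b⁆ * c * d := by group
  have h4 : ⁅a, b⁆ * ⁅c, d⁆ * d = ⁅a, b⁆ * c * d * c⁻¹ := by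
    rw [commutatorElement_def c]; group
  simp only [surfaceSum, h1, h2, h3, h4]
  rw [h, one_mul]
  abel

lemma surfaceSum_add {G A : Type} [Group G] [AddCommGroup A] (u v : G × G → A) (a b c d : G) :
    surfaceSum (u + v) a b c d = surfaceSum u a b c d + surfaceSum v a b c d := by
  simp only [surfaceSum, Pi.add_apply]
  abel

lemma surfaceSum_intCast {G : Type} [Group G] (u : G × G → ℤ) (a b c d : G) :
    surfaceSum (fun p => (u p : ℝ)) a b c d = (surfaceSum u a b c d : ℤ) := by
  simp only [surfaceSum]
  push_cast
  rfl

lemma surfaceSum_le {G : Type} [Group G] {u : G × G → ℝ} {C : ℝ} (h : ∀ g h, |u (g, h)| ≤ C)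
    (a b c d : G) : surfaceSum u a b c d ≤ 8 * C := by
  have h1 := fun x y => (abs_le.1 (h x y)).1
  have h2 := fun x y => (abs_le.1 (h x y)).2
  unfold surfaceSum
  linarith [h2 1 a, h2 a b, h1 (a * b * a⁻¹) a, h1 ⁅a, b⁆ b, h2 ⁅a, b⁆ c, h2 (⁅a, b⁆ * c) d,
    h1 (⁅a, b⁆ * c * d * c⁻¹) c, h1 (⁅a, b⁆ * ⁅c, d⁆) d]

/-! ### Commutators of lifts in a central extension by ℤ -/

section ext
variable {E G : Type} [Group E] [Group G] (S : GroupExtension (Multiplicative ℤ) E G)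

/-- The extension cocycle evaluated on the fundamental cycle is the product of commutators of lifts
of the generators. -/
lemma inl_surfaceSum (hS : ∀ n x, Commute (S.inl n) x) (σ : S.Section) {a b c d : G} (h : ⁅a, b⁆ * ⁅c, d⁆ = 1) :
    S.inl (Multiplicative.ofAdd (surfaceSum (extCocycleFun S σ) a b c d)) =
      ⁅σ a, σ b⁆ * ⁅σ c, σ d⁆ := by
  let I : G → G → E := fun g h => S.inl (Multiplicative.ofAdd (extCocycleFun S σ (g, h)))
  have hm : ∀ g h, σ g * σ h = I g h * σ (g * h) := fun g h => by
    simp only [I, inl_extCocycleFun]; group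
  have hd : ∀ g h, σ (g * h) * (σ h)⁻¹ = (I g h)⁻¹ * σ g := fun g h => by
    rw [mul_inv_eq_iff_eq_mul, mul_assoc, hm]; group
  -- Reading the four letters of a commutator after the prefix `p` costs four cocycle values, one
  -- per letter. The prefixes `1` and `⁅a, b⁆` produce the eight terms of the fundamental cycle.
  have hcomm : ∀ p x y : G, σ p * ⁅σ x, σ y⁆ =
      I p x * I (p * x) y * (I (p * x * y * x⁻¹) x)⁻¹ * (I (p * ⁅x, y⁆) y)⁻¹ * σ (p * ⁅x, y⁆) := by
    intro p x y
    have e1 : p * x * y * x⁻¹ * x = p * x * y := by group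
    have e2 : p * ⁅x, y⁆ * y = p * x * y * x⁻¹ := by rw [commutatorElement_def]; group
    have k1 := hd (p * x * y * x⁻¹) x
    have k2 := hd (p * ⁅x, y⁆) y
    rw [e1] at k1
    rw [e2] at k2
    calc σ p * ⁅σ x, σ y⁆ = σ p * σ x * σ y * (σ x)⁻¹ * (σ y)⁻¹ := by
          rw [commutatorElement_def]; group
      _ = I p x * (I (p * x) y * ((σ (p * x * y) * (σ x)⁻¹) * (σ y)⁻¹)) := by
          rw [hm, mul_assoc (I p x), hm]; group
      _ = I p x * (I (p * x) y * ((I (p * x * y * x⁻¹) x)⁻¹ *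
            (σ (p * x * y * x⁻¹) * (σ y)⁻¹))) := by rw [k1]; group
      _ = _ := by rw [k2]; group
  have h1 := hcomm 1 a b
  have h2 := hcomm ⁅a, b⁆ c d
  simp only [one_mul] at h1
  -- The section need not be normalised, so `σ 1` is carried along on both sides and cancelled at
  -- the end by centrality.
  have h3 : σ 1 * (⁅σ a, σ b⁆ * ⁅σ c, σ d⁆) =
      S.inl (Multiplicative.ofAdd (surfaceSum (extCocycleFun S σ) a b c d)) * σ 1 := by
    rw [← mul_assoc, h1, mul_assoc, h2]
    simp only [I, h, surfaceSum, sub_eq_add_neg, ofAdd_add, map_mul, ofAdd_neg, map_inv, mul_assoc]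
  rw [(hS _ (σ 1)).eq] at h3
  exact (mul_left_cancel h3).symm

/-- Commutators in a central extension only depend on the images. -/
lemma commutator_section (hS : ∀ n x, Commute (S.inl n) x) (σ : S.Section)
    (x y : E) :
    ⁅σ (S.rightHom x), σ (S.rightHom y)⁆ = ⁅x, y⁆ := by
  -- Each element differs from the chosen lift of its image by a central factor, and in a commutator
  -- that factor meets its own inverse.
  have key : ∀ x : E, ∃ n, x = S.inl n * σ (S.rightHom x) := by
    intro x
    have : x * (σ (S.rightHom x))⁻¹ ∈ S.rightHom.ker := by
      rw [MonoidHom.mem_ker, map_mul, map_inv, σ.rightHom_section, mul_inv_cancel]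
    rw [← S.range_inl_eq_ker_rightHom] at this
    obtain ⟨n, hn⟩ := this
    exact ⟨n, by rw [hn]; group⟩
  obtain ⟨m, hm⟩ := key x
  obtain ⟨n, hn⟩ := key y
  generalize σ (S.rightHom x) = x' at *
  generalize σ (S.rightHom y) = y' at *
  subst hm hn
  have c := hS
  simp only [commutatorElement_def, mul_inv_rev]
  calc x' * y' * x'⁻¹ * y'⁻¹
      = S.inl m * (S.inl n * (x' * y' * x'⁻¹ * y'⁻¹)) * (S.inl n)⁻¹ * (S.inl m)⁻¹ := by
        rw [(c n _).eq, ← mul_assoc, mul_inv_cancel_right, (c m _).eq, mul_inv_cancel_right]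
    _ = S.inl m * ((S.inl n * x') * y' * x'⁻¹ * y'⁻¹) * (S.inl n)⁻¹ * (S.inl m)⁻¹ := by group
    _ = S.inl m * x' * (S.inl n * y') * x'⁻¹ * (y'⁻¹ * (S.inl n)⁻¹ * (S.inl m)⁻¹) := by
        rw [(c n x').eq]; group
    _ = S.inl m * x' * (S.inl n * y') * x'⁻¹ * ((S.inl m)⁻¹ * (y'⁻¹ * (S.inl n)⁻¹)) := by
        rw [((c m (y'⁻¹ * (S.inl n)⁻¹)).inv_left).eq]
    _ = _ := by group

end ext

/-! ## Some orientation-preserving diffeomorphisms of the plane -/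

/-- For a diffeomorphism it is enough to check the orientation at one point. -/
lemma mem_diffeoPlus {f : Equiv.Perm ℂ} (hf : ContDiff ℝ ∞ f) (hf' : ContDiff ℝ ∞ f.symm) {z₀ : ℂ}
    (h₀ : 0 < (fderiv ℝ f z₀).det) : f ∈ DiffeoPlus := by
  refine ⟨hf, hf', fun z => ?_⟩
  have hne : ∀ z, (fderiv ℝ f z).det ≠ 0 := fun z => by
    have h : (fderiv ℝ f.symm (f z)).comp (fderiv ℝ f z) = ContinuousLinearMap.id ℝ ℂ := by
      rw [← fderiv_comp z (hf'.differentiable (by simp) _) (hf.differentiable (by simp) _)]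
      have : (⇑f.symm ∘ ⇑f) = id := by ext; simp
      rw [this]; exact fderiv_id
    have h1 : (fderiv ℝ f.symm (f z)).det * (fderiv ℝ f z).det = 1 := by
      rw [ContinuousLinearMap.det, ContinuousLinearMap.det, ← LinearMap.det_comp,
        ← ContinuousLinearMap.toLinearMap_comp, h]; simp
    exact right_ne_zero_of_mul_eq_one h1
  have hc : Continuous fun z => (fderiv ℝ f z).det :=
    ContinuousLinearMap.continuous_det.comp (hf.continuous_fderiv (by simp))
  -- The determinant is continuous and nowhere zero on the connected plane, so it cannot change
  -- sign.
  by_contra! hz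
  obtain ⟨w, -, hw⟩ := isPreconnected_univ.intermediate_value (Set.mem_univ z) (Set.mem_univ z₀)
    hc.continuousOn ⟨hz, h₀.le⟩
  exact hne w hw

lemma mem_diffeoPlus_of_eventuallyEq {f : Equiv.Perm ℂ} (hf : ContDiff ℝ ∞ f)
    (hf' : ContDiff ℝ ∞ f.symm) {z₀ : ℂ} (h₀ : f =ᶠ[𝓝 z₀] id) : f ∈ DiffeoPlus := by
  refine mem_diffeoPlus hf hf' (z₀ := z₀) ?_
  rw [h₀.fderiv_eq, fderiv_id]
  simp [ContinuousLinearMap.det]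

/-- The translation `z ↦ z + a`. -/
def translation (a : ℂ) : DiffeoPlus :=
  ⟨Equiv.addRight a, mem_diffeoPlus (z₀ := 0) (contDiff_id.add contDiff_const)
    (contDiff_id.add contDiff_const) (by
      have : fderiv ℝ (⇑(Equiv.addRight a)) 0 = ContinuousLinearMap.id ℝ ℂ :=
        ((hasFDerivAt_id (𝕜 := ℝ) (0 : ℂ)).add_const a).fderiv
      rw [this]
      simp [ContinuousLinearMap.det])⟩

/-- The doubling map `z ↦ 2z`. -/
def doubling : DiffeoPlus :=
  ⟨Equiv.mulLeft₀ 2 two_ne_zero, mem_diffeoPlus (z₀ := 0) (contDiff_const.mul contDiff_id)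
    (contDiff_const.mul contDiff_id) (by
      have : fderiv ℝ (⇑(Equiv.mulLeft₀ (2 : ℂ) two_ne_zero)) 0 =
          (2 : ℂ) • ContinuousLinearMap.id ℝ ℂ :=
        ((hasFDerivAt_id (𝕜 := ℝ) (0 : ℂ)).const_mul 2).fderiv
      rw [this]
      have : (2 : ℂ) • ContinuousLinearMap.id ℝ ℂ = (2 : ℝ) • ContinuousLinearMap.id ℝ ℂ := by
        ext z; simp
      rw [this, ContinuousLinearMap.det, ContinuousLinearMap.toLinearMap_smul, LinearMap.det_smul]
      simp)⟩

/-- The map rotating the circle `|z|² = s` by the angle `θ s`. -/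
def twistEquiv (θ : ℝ → ℝ) : Equiv.Perm ℂ where
  toFun z := z * Complex.exp (θ (Complex.normSq z) * Complex.I)
  invFun z := z * Complex.exp (-θ (Complex.normSq z) * Complex.I)
  left_inv z := by
    simp only [Complex.normSq_mul, Complex.normSq_eq_norm_sq (Complex.exp _),
      Complex.norm_exp_ofReal_mul_I]
    rw [one_pow, mul_one, mul_assoc, ← Complex.exp_add]
    simp
  right_inv z := by
    simp only [Complex.normSq_mul, Complex.normSq_eq_norm_sq (Complex.exp _),
      ← Complex.ofReal_neg, Complex.norm_exp_ofReal_mul_I]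
    rw [one_pow, mul_one, mul_assoc, ← Complex.exp_add]
    simp

lemma contDiff_twist {θ : ℝ → ℝ} (hθ : ContDiff ℝ ∞ θ) :
    ContDiff ℝ ∞ fun z => z * Complex.exp (θ (Complex.normSq z) * Complex.I) := by
  have h1 : ContDiff ℝ ∞ fun z : ℂ => Complex.normSq z := by
    simp only [Complex.normSq_apply]
    have hr : ContDiff ℝ ∞ Complex.re := Complex.reCLM.contDiff
    have hi : ContDiff ℝ ∞ Complex.im := Complex.imCLM.contDiff
    fun_prop
  have h2 : ContDiff ℝ ∞ fun z : ℂ => ((θ (Complex.normSq z) : ℝ) : ℂ) :=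
    Complex.ofRealCLM.contDiff.comp (hθ.comp h1)
  exact contDiff_id.mul (h2.mul contDiff_const).cexp

/-- The twist by a smooth angle function vanishing at the origin. -/
def twist (θ : ℝ → ℝ) (hθ : ContDiff ℝ ∞ θ) (h0 : θ 0 = 0) : DiffeoPlus :=
  ⟨twistEquiv θ, mem_diffeoPlus (z₀ := 0) (contDiff_twist hθ)
    (by
      have := contDiff_twist hθ.neg
      simp only [Complex.ofReal_neg] at this
      exact this)
    (by
      have h1 : DifferentiableAt ℝ
          (fun z : ℂ => Complex.exp (θ (Complex.normSq z) * Complex.I)) 0 := by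
        have hn : DifferentiableAt ℝ (fun z : ℂ => Complex.normSq z) 0 := by
          simp only [Complex.normSq_apply]
          have hr : Differentiable ℝ Complex.re := Complex.reCLM.differentiable
          have hi : Differentiable ℝ Complex.im := Complex.imCLM.differentiable
          fun_prop
        have h2 : DifferentiableAt ℝ (fun z : ℂ => ((θ (Complex.normSq z) : ℝ) : ℂ)) 0 :=
          Complex.ofRealCLM.differentiableAt.comp _
            ((hθ.differentiable (by simp) _).comp (0 : ℂ) hn)
        exact (h2.mul_const _).cexp
      -- In the product rule at 0 one term is killed by the factor `z = 0`, and in the other the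
      -- rotation factor is 1 because `θ 0 = 0`.
      have h2 : fderiv ℝ (⇑(twistEquiv θ)) 0 = ContinuousLinearMap.id ℝ ℂ := by
        have := ((hasFDerivAt_id (𝕜 := ℝ) (0 : ℂ)).mul h1.hasFDerivAt).fderiv
        refine this.trans ?_
        simp [h0]
      rw [h2]
      simp [ContinuousLinearMap.det])⟩

/-! ### Infinite products of translates -/

section spread

/-- The nearest point to `z` among `0, 10, 20, …`. -/
def center (z : ℂ) : ℕ := (round (z.re / 10)).toNat

/-- The infinite product of the conjugates of `K` by the translations by `10 k`, for
`k = 0, 1, 2, …`, when `K` is supported in a small disc around the origin. -/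
def spreadFun (K : Equiv.Perm ℂ) (z : ℂ) : ℂ := 10 * center z + K (z - 10 * center z)

lemma center_eq {z : ℂ} {k : ℕ} (h : ‖z - 10 * k‖ < 3) : center z = k := by
  have h1 := (Complex.abs_re_le_norm (z - 10 * k)).trans_lt h
  have h2 : (z - 10 * k).re = z.re - 10 * k := by simp
  rw [h2, abs_lt] at h1
  have : round (z.re / 10) = k := by
    rw [round_eq, Int.floor_eq_iff]
    push_cast
    constructor <;> linarith
  rw [center, this, Int.toNat_natCast]

variable {K : Equiv.Perm ℂ} (hK : ∀ z, 2 ≤ ‖z‖ → K z = z)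

lemma spreadFun_of_norm_lt {z : ℂ} {k : ℕ} (h : ‖z - 10 * k‖ < 3) :
    spreadFun K z = 10 * k + K (z - 10 * k) := by
  rw [spreadFun, center_eq h]

include hK

lemma spreadFun_of_le {z : ℂ} (h : ∀ k : ℕ, 2 ≤ ‖z - 10 * k‖) : spreadFun K z = z := by
  rw [spreadFun, hK _ (h _)]
  ring

lemma symm_apply_of_le (z : ℂ) (hz : 2 ≤ ‖z‖) : K.symm z = z := by
  rw [Equiv.symm_apply_eq, hK z hz]

lemma norm_apply_lt {z : ℂ} (hz : ‖z‖ < 2) : ‖K z‖ < 2 := by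
  by_contra! h
  rw [K.injective (hK _ h)] at h
  exact hz.not_ge h

/-- `K` maps the disc of radius 2 to itself, so a point and its image have the same centre and the
inverse can be taken disc by disc. -/
lemma spreadFun_symm_spreadFun (z : ℂ) : spreadFun K.symm (spreadFun K z) = z := by
  by_cases h : ∃ k : ℕ, ‖z - 10 * k‖ < 2
  · obtain ⟨k, hk⟩ := h
    have h2 := norm_apply_lt hK hk
    rw [spreadFun_of_norm_lt (k := k) (z := z) (by linarith), spreadFun_of_norm_lt (k := k)]
    · simp
    · rw [add_sub_cancel_left]; linarith
  · push Not at h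
    rw [spreadFun_of_le hK h, spreadFun_of_le (symm_apply_of_le hK) h]

/-- The bijection underlying `spreadFun`. -/
def spreadEquiv : Equiv.Perm ℂ where
  toFun := spreadFun K
  invFun := spreadFun K.symm
  left_inv := spreadFun_symm_spreadFun hK
  right_inv := spreadFun_symm_spreadFun (symm_apply_of_le hK)

/-- The gap between the radii 2 (support) and 3 leaves room for a unit ball outside every supporting
disc. Smoothness is then local: near a point either a single translate of `K` acts, or none does. -/
lemma spreadFun_eventuallyEq {z : ℂ} (h : ∀ k : ℕ, 3 ≤ ‖z - 10 * k‖) : spreadFun K =ᶠ[𝓝 z] id := by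
  filter_upwards [Metric.ball_mem_nhds z one_pos] with w hw
  refine spreadFun_of_le hK fun k => ?_
  have h1 := norm_sub_le_norm_sub_add_norm_sub z w (10 * (k : ℂ))
  rw [Metric.mem_ball, dist_comm, dist_eq_norm] at hw
  linarith [h k]

lemma contDiff_spreadFun (hc : ContDiff ℝ ∞ K) : ContDiff ℝ ∞ (spreadFun K) := by
  rw [contDiff_iff_contDiffAt]
  intro z
  by_cases h : ∃ k : ℕ, ‖z - 10 * k‖ < 3
  · obtain ⟨k, hk⟩ := h
    have h1 : ContDiff ℝ ∞ fun z => 10 * (k : ℂ) + K (z - 10 * k) :=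
      contDiff_const.add (hc.comp (contDiff_id.sub contDiff_const))
    refine h1.contDiffAt.congr_of_eventuallyEq ?_
    have ho : IsOpen {w : ℂ | ‖w - 10 * k‖ < 3} := isOpen_lt (by fun_prop) continuous_const
    filter_upwards [ho.mem_nhds hk] with w hw using spreadFun_of_norm_lt hw
  · push Not at h
    exact contDiffAt_id.congr_of_eventuallyEq (spreadFun_eventuallyEq hK h)

lemma spreadFun_of_re_le {z : ℂ} (h : z.re ≤ -3) : spreadFun K z = z := by
  refine spreadFun_of_le hK fun k => ?_
  have h1 := Complex.abs_re_le_norm (z - 10 * k)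
  have h2 : (z - 10 * k).re = z.re - 10 * k := by simp
  have h3 : (0 : ℝ) ≤ k := k.cast_nonneg
  have h4 := neg_abs_le (z - 10 * k).re
  linarith

/-- With `S = spreadFun K` and `T` the translation by 10, this reads `S T = K T S`: the copies
carried over by `T` sit at `10, 20, …`, and the one missing at 0 is supplied by `K`. -/
lemma spreadFun_add (z : ℂ) : spreadFun K (z + 10) = K (spreadFun K z + 10) := by
  have hre : ∀ w : ℂ, 2 ≤ |w.re| → 2 ≤ ‖w‖ := fun w hw => hw.trans (Complex.abs_re_le_norm w)
  have hd : ((z + 10).re / 10) = z.re / 10 + 1 := by simp [add_div]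
  have hround := abs_sub_round (z.re / 10)
  rw [abs_le] at hround
  rcases le_or_gt 0 (round (z.re / 10)) with h | h
  -- To the right the centre moves along with the point, so `S` commutes with the translation here,
  -- and the image has real part at least 2, where `K` does nothing.
  · have hc : center (z + 10) = center z + 1 := by
      rw [center, center, hd, round_add_one]; omega
    have h1 : spreadFun K (z + 10) = spreadFun K z + 10 := by
      rw [spreadFun, spreadFun, hc]
      push_cast
      rw [show z + 10 - 10 * ((center z : ℂ) + 1) = z - 10 * center z by ring]
      ring
    rw [h1, hK]
    apply hre
    refine le_trans ?_ (le_abs_self _)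
    have h0 : (0 : ℝ) ≤ round (z.re / 10) := by exact_mod_cast h
    by_cases h2 : ‖z - 10 * center z‖ < 2
    · have h3 := neg_abs_le (K (z - 10 * center z)).re
      have h4 := Complex.abs_re_le_norm (K (z - 10 * center z))
      have h5 := norm_apply_lt hK h2
      have h6 : (0 : ℝ) ≤ center z := (center z).cast_nonneg
      rw [spreadFun]
      simp only [Complex.add_re, Complex.mul_re, Complex.natCast_re, Complex.natCast_im]
      norm_num
      linarith
    · rw [spreadFun, hK _ (not_lt.1 h2)]
      simp only [add_sub_cancel, Complex.add_re]
      norm_num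
      linarith
  -- To the left `S` fixes `z`. Since `toNat` sends nonpositive integers to 0, the centre of `z +
  -- 10` is 0 and `S` acts there as `K` itself.
  · have h0 : (round (z.re / 10) : ℝ) ≤ -1 := by exact_mod_cast Int.le_sub_one_of_lt h
    rw [spreadFun_of_re_le hK (z := z) (by linarith)]
    have hc : center (z + 10) = 0 := by
      rw [center, hd, round_add_one]; omega
    rw [spreadFun, hc]
    simp

/-- The diffeomorphism underlying `spreadFun`. -/
def spread (hc : ContDiff ℝ ∞ K) (hc' : ContDiff ℝ ∞ K.symm) : DiffeoPlus :=
  ⟨spreadEquiv hK, mem_diffeoPlus_of_eventuallyEq (z₀ := -10) (contDiff_spreadFun hK hc)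
    (contDiff_spreadFun (symm_apply_of_le hK) hc') (spreadFun_eventuallyEq hK fun k => by
      have h1 := Complex.abs_re_le_norm (-10 - 10 * k : ℂ)
      have h2 : (-10 - 10 * k : ℂ).re = -10 - 10 * k := by simp
      have h3 : (0 : ℝ) ≤ k := k.cast_nonneg
      have h4 := neg_abs_le (-10 - 10 * k : ℂ).re
      linarith)⟩

lemma commutator_spread (hc : ContDiff ℝ ∞ K) (hc' : ContDiff ℝ ∞ K.symm) :
    ((⁅spread hK hc hc', translation 10⁆ : DiffeoPlus) : Equiv.Perm ℂ) = K := by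
  change spreadEquiv hK * Equiv.addRight 10 * (spreadEquiv hK)⁻¹ * (Equiv.addRight 10)⁻¹ = K
  rw [mul_inv_eq_iff_eq_mul, mul_inv_eq_iff_eq_mul]
  exact Equiv.ext (spreadFun_add hK)

end spread

/-! ### The angle functions -/

/-- A smooth function equal to `c * log s` for `s ≥ 1`. -/
def angle (c : ℝ) (s : ℝ) : ℝ := c * Real.log (1 + Real.smoothTransition s * (s - 1))

lemma angle_zero (c : ℝ) : angle c 0 = 0 := by simp [angle]

lemma angle_of_one_le (c : ℝ) {s : ℝ} (hs : 1 ≤ s) : angle c s = c * Real.log s := by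
  simp [angle, Real.smoothTransition.one_of_one_le hs]

lemma contDiff_angle (c : ℝ) : ContDiff ℝ ∞ (angle c) := by
  refine contDiff_const.mul (ContDiff.log ?_ fun s => ne_of_gt ?_)
  · exact contDiff_const.add (Real.smoothTransition.contDiff.mul (contDiff_id.sub contDiff_const))
  -- The argument of the logarithm is the convex combination of 1 and `s` with weight
  -- `smoothTransition s` on `s`; this weight vanishes for `s ≤ 0`, so the argument stays positive.
  · have h1 := Real.smoothTransition.le_one s
    have h0 := Real.smoothTransition.nonneg s
    rcases le_or_gt s 0 with h | h
    · simp [Real.smoothTransition.zero_of_nonpos h]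
    · rcases le_total 1 s with h' | h'
      · nlinarith [mul_nonneg h0 (sub_nonneg.2 h')]
      · nlinarith

/-- Doubling `z` multiplies `|z|²` by 4, which is why the constant is divided by `log 4`: the angle
drops by exactly `n` full turns. These are invisible in the plane but not on the universal cover. -/
lemma angle_sub_angle (n : ℤ) {s : ℝ} (hs : 1 ≤ s) :
    angle (-(2 * π * n) / Real.log 4) s - angle (-(2 * π * n) / Real.log 4) (4 * s) =
      2 * π * n := by
  rw [angle_of_one_le _ hs, angle_of_one_le _ (by linarith), Real.log_mul (by norm_num)
    (by linarith)]
  have : Real.log 4 ≠ 0 := (Real.log_pos (by norm_num)).ne'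
  field_simp
  ring

/-- The twist by an angle growing logarithmically. -/
def logTwist (n : ℤ) : DiffeoPlus :=
  twist (angle (-(2 * π * n) / Real.log 4)) (contDiff_angle _) (angle_zero _)

lemma doubling_mul_logTwist (n : ℤ) {z : ℂ} (hz : 1 ≤ ‖z‖) :
    (doubling * logTwist n : DiffeoPlus).1 z = (logTwist n * doubling : DiffeoPlus).1 z := by
  have h1 : (doubling * logTwist n : DiffeoPlus).1 z = 2 * (z * Complex.exp
    ((angle (-(2 * π * n) / Real.log 4) (Complex.normSq z) : ℝ) * Complex.I)) := rfl
  have h2 : (logTwist n * doubling : DiffeoPlus).1 z = (2 * z) * Complex.exp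
    ((angle (-(2 * π * n) / Real.log 4) (Complex.normSq (2 * z)) : ℝ) * Complex.I) := rfl
  have h3 : Complex.normSq (2 * z) = 4 * Complex.normSq z := by
    rw [Complex.normSq_mul]; norm_num [Complex.normSq_apply]
  have h4 := angle_sub_angle n (s := Complex.normSq z) (by
    rw [Complex.normSq_eq_norm_sq]; nlinarith)
  rw [h1, h2, h3, ← mul_assoc]
  congr 1
  rw [Complex.exp_eq_exp_iff_exists_int]
  refine ⟨n, ?_⟩
  rw [sub_eq_iff_eq_add] at h4
  rw [h4]
  push_cast
  ring

lemma commutator_doubling_logTwist (n : ℤ) {z : ℂ} (hz : 2 ≤ ‖z‖) :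
    (⁅doubling, logTwist n⁆ : DiffeoPlus).1 z = z := by
  -- In terms of `w` the claim becomes `⁅a, b⁆ (b a w) = a b w = b a w`. The radius 2 comes from `|b
  -- a w| = 2|w|`, as the last equality needs `|w| ≥ 1`.
  obtain ⟨w, rfl⟩ := (logTwist n * doubling : DiffeoPlus).1.surjective z
  have h1 : ‖(logTwist n * doubling : DiffeoPlus).1 w‖ = 2 * ‖w‖ := by
    have h2 : (logTwist n * doubling : DiffeoPlus).1 w = (2 * w) * Complex.exp
      ((angle (-(2 * π * n) / Real.log 4) (Complex.normSq (2 * w)) : ℝ) * Complex.I) := rfl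
    rw [h2, norm_mul, Complex.norm_exp_ofReal_mul_I]
    simp
  rw [h1] at hz
  have h3 : ⁅doubling, logTwist n⁆ * (logTwist n * doubling) = doubling * logTwist n := by
    rw [commutatorElement_def]; group
  have h4 := congrArg (fun g : DiffeoPlus => g.1 w) h3
  exact h4.trans (doubling_mul_logTwist n (by linarith))

/-! ## Lifts of germs -/

/-- The end map `w ↦ w + a + i u(re w)`. -/
def shear (a : ℝ) (u : C(ℝ, ℝ)) : EndMap where
  toFun w := w + a + u w.re * Complex.I
  continuousOn := ⟨0, by fun_prop⟩
  tendsto := by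
    rw [endFilter, tendsto_comap_iff]
    have : (Complex.re ∘ fun w : ℂ => w + a + u w.re * Complex.I) = fun w => w.re + a := by
      funext w; simp
    rw [this]; exact tendsto_atTop_add_const_right _ a tendsto_comap

lemma shear_apply (a : ℝ) (u : C(ℝ, ℝ)) (w : ℂ) : shear a u w = w + a + u w.re * Complex.I := rfl

/-- The unit `w ↦ w + a` of the monoid of germs. -/
def shiftUnit (a : ℝ) : EndGermsˣ where
  val := (shear a 0 : EndGerms)
  inv := (shear (-a) 0 : EndGerms)
  val_inv := by
    rw [← Con.coe_mul, ← Con.coe_one]; congr 1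
    ext w; simp [EndMap.mul_apply, EndMap.one_apply, shear_apply]
  inv_val := by
    rw [← Con.coe_mul, ← Con.coe_one]; congr 1
    ext w; simp [EndMap.mul_apply, EndMap.one_apply, shear_apply]

/-- The unit `w ↦ w + i u(re w)` of the monoid of germs. -/
def rotationUnit (u : C(ℝ, ℝ)) : EndGermsˣ where
  val := (shear 0 u : EndGerms)
  inv := (shear 0 (-u) : EndGerms)
  val_inv := by
    rw [← Con.coe_mul, ← Con.coe_one]; congr 1
    ext w; simp [EndMap.mul_apply, EndMap.one_apply, shear_apply]
  inv_val := by
    rw [← Con.coe_mul, ← Con.coe_one]; congr 1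
    ext w; simp [EndMap.mul_apply, EndMap.one_apply, shear_apply]

lemma shear_commute_deck (a : ℝ) (u : C(ℝ, ℝ)) (n : Multiplicative ℤ) :
    (shear a u : EndGerms) * deck n = deck n * (shear a u : EndGerms) := by
  rw [deck_val, ← Con.coe_mul, ← Con.coe_mul]; congr 1
  ext w
  simp only [EndMap.mul_apply, shear_apply, deckMap]
  simp
  ring

/-- The angle of `logTwist n`, in logarithmic coordinates. -/
def logAngle (n : ℤ) : C(ℝ, ℝ) :=
  ⟨fun x => angle (-(2 * π * n) / Real.log 4) (Real.exp (2 * x)),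
    (contDiff_angle _).continuous.comp (by fun_prop)⟩

lemma shiftUnit_mem : (doubling, shiftUnit (Real.log 2)) ∈ LiftGroup := by
  refine ⟨covers_mk.2 (Eventually.of_forall fun w => ?_), Units.ext (shear_commute_deck _ _ _)⟩
  have h : doubling.1 (Complex.exp w) = 2 * Complex.exp w := rfl
  rw [h, shear_apply, ContinuousMap.zero_apply, Complex.ofReal_zero, zero_mul, add_zero,
    Complex.exp_add, ← Complex.ofReal_exp, Real.exp_log two_pos, mul_comm]
  simp

lemma rotationUnit_mem (n : ℤ) : (logTwist n, rotationUnit (logAngle n)) ∈ LiftGroup := by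
  refine ⟨covers_mk.2 (Eventually.of_forall fun w => ?_), Units.ext (shear_commute_deck _ _ _)⟩
  have h : (logTwist n).1 (Complex.exp w) = Complex.exp w * Complex.exp
    ((angle (-(2 * π * n) / Real.log 4) (Complex.normSq (Complex.exp w)) : ℝ) * Complex.I) := rfl
  have h2 : Complex.normSq (Complex.exp w) = Real.exp (2 * w.re) := by
    rw [Complex.normSq_eq_norm_sq, Complex.norm_exp, ← Real.exp_nat_mul]; norm_cast
  rw [h, h2, ← Complex.exp_add, shear_apply, Complex.ofReal_zero, add_zero]
  rfl

/-- This is the source of the Euler number: shifting by `log 2` lowers the shear's angle by `2πn`,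
which upstairs is a genuine translation. -/
lemma commutator_shiftUnit_rotationUnit (n : ℤ) :
    ⁅shiftUnit (Real.log 2), rotationUnit (logAngle n)⁆ = deck (Multiplicative.ofAdd n) := by
  rw [commutatorElement_def, mul_inv_eq_iff_eq_mul, mul_inv_eq_iff_eq_mul]
  refine Units.ext ?_
  show (shear (Real.log 2) 0 : EndGerms) * (shear 0 (logAngle n) : EndGerms) =
    (deckMap n : EndGerms) * (shear 0 (logAngle n) : EndGerms) * (shear (Real.log 2) 0 : EndGerms)
  rw [← Con.coe_mul, ← Con.coe_mul, ← Con.coe_mul, Con.eq]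
  -- On the half plane `0 < re w` one has `|exp w| > 1`, where the angle is exactly logarithmic.
  refine eventually_endFilter.2 ⟨0, fun w hw => ?_⟩
  have h1 := angle_sub_angle n (s := Real.exp (2 * w.re)) (Real.one_le_exp (by linarith))
  have h2 : Real.exp (2 * (w.re + Real.log 2)) = 4 * Real.exp (2 * w.re) := by
    rw [mul_add, Real.exp_add, two_mul (Real.log 2), Real.exp_add, Real.exp_log two_pos]; ring
  have h3 : logAngle n w.re = logAngle n (w.re + Real.log 2) + 2 * π * n := by
    rw [sub_eq_iff_eq_add'] at h1
    rw [← h2] at h1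
    exact h1
  simp only [EndMap.mul_apply, shear_apply, deckMap]
  simp only [ContinuousMap.zero_apply, Complex.ofReal_zero, zero_mul, add_zero, Complex.add_re,
    Complex.ofReal_re, h3]
  push_cast
  ring

/-! ### Germs preserving the negative real axis -/

/-- The germ preserves the end of the line `im w = π` over the negative real axis. -/
def PreservesRay (φ : EndGerms) : Prop :=
  ∃ F : EndMap, (F : EndGerms) = φ ∧ ∀ᶠ x : ℝ in atTop, (F (x + π * Complex.I)).im = π

lemma tendsto_ray : Tendsto (fun x : ℝ => (x + π * Complex.I : ℂ)) atTop endFilter := by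
  rw [endFilter, tendsto_comap_iff]
  have : (Complex.re ∘ fun x : ℝ => (x + π * Complex.I : ℂ)) = id := by funext x; simp
  rw [this]
  exact tendsto_id

lemma PreservesRay.mul {φ ψ : EndGerms} (hφ : PreservesRay φ) (hψ : PreservesRay ψ) :
    PreservesRay (φ * ψ) := by
  obtain ⟨F, rfl, hF⟩ := hφ
  obtain ⟨H, rfl, hH⟩ := hψ
  refine ⟨F * H, rfl, ?_⟩
  -- The condition on `F` holds only far out along the ray, so `H` must be seen to push the ray to
  -- its end.
  have h1 : Tendsto (fun x : ℝ => (H (x + π * Complex.I)).re) atTop atTop :=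
    tendsto_comap.comp (H.tendsto.comp tendsto_ray)
  filter_upwards [hH, h1.eventually hF] with x h2 h3
  rw [EndMap.mul_apply, ← Complex.re_add_im (H (x + π * Complex.I)), h2]
  exact h3

lemma PreservesRay.eventually {F : EndMap} (h : PreservesRay (F : EndGerms)) :
    ∀ᶠ x : ℝ in atTop, (F (x + π * Complex.I)).im = π := by
  obtain ⟨H, hH, h⟩ := h
  have h1 : (H : ℂ → ℂ) =ᶠ[endFilter] F := (Con.eq germCon).1 hH
  filter_upwards [h, tendsto_ray.eventually h1] with x h2 h3
  rw [← h3, h2]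

/-- Lifting depends only on the germ at infinity, so a lift of a compactly supported diffeomorphism
also covers the identity. -/
lemma Covers.congr {g h : Equiv.Perm ℂ} {φ : EndGerms} (hφ : Covers g φ)
    (e : g =ᶠ[cocompact ℂ] h) : Covers h φ := by
  obtain ⟨F, rfl, hF⟩ := hφ
  refine ⟨F, rfl, ?_⟩
  filter_upwards [hF, tendsto_exp_endFilter.eventually e] with w h1 h2
  rw [h1, h2]

/-- A diffeomorphism preserving the end of the negative real axis has a lift preserving the line
`im w = π`. -/
lemma exists_preservesRay (g : DiffeoPlus)
    (hg : ∀ᶠ x : ℝ in atTop, ∃ y : ℝ, 0 < y ∧ g.1 (-x : ℂ) = (-y : ℂ)) :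
    ∃ φ : EndGermsˣ, (g, φ) ∈ LiftGroup ∧ PreservesRay (φ : EndGerms) := by
  obtain ⟨φ, hφ⟩ := exists_mem_liftGroup g
  obtain ⟨F, hF, hcov⟩ := hφ.1
  obtain ⟨R, hR⟩ := F.continuousOn
  obtain ⟨S, hS⟩ := eventually_atTop.1 ((tendsto_ray.eventually hcov).and
    (Real.tendsto_exp_atTop.eventually hg))
  -- Negative reals go to negative reals, so over the ray the imaginary part of the lift is `π`
  -- modulo `2π`; by continuity it is a constant `π + 2πn`.
  have hexp : ∀ x ∈ Set.Ioi (max R S),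
      Complex.exp (((F (x + π * Complex.I)).im - π : ℝ) * Complex.I) = 1 := by
    intro x hx
    obtain ⟨h1, y, hy, h2⟩ := hS x ((le_max_right R S).trans (le_of_lt hx))
    have h3 : Complex.exp (F (x + π * Complex.I)) = -y := by
      rw [h1, Complex.exp_add, Complex.exp_pi_mul_I, ← h2, Complex.ofReal_exp, mul_neg_one]
    have h4 : Real.exp (F (x + π * Complex.I)).re = y := by
      rw [← Complex.norm_exp, h3, norm_neg, Complex.norm_real, Real.norm_of_nonneg hy.le]
    have h5 : (y : ℂ) * Complex.exp ((F (x + π * Complex.I)).im * Complex.I) = -y := by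
      rw [← h3, ← h4, Complex.ofReal_exp, ← Complex.exp_add, Complex.re_add_im]
    have hy' : (y : ℂ) ≠ 0 := by exact_mod_cast hy.ne'
    rw [Complex.ofReal_sub, sub_mul, Complex.exp_sub, Complex.exp_pi_mul_I]
    have h6 : Complex.exp ((F (x + π * Complex.I)).im * Complex.I) = -1 :=
      mul_left_cancel₀ hy' (by rw [h5]; ring)
    rw [h6]
    norm_num
  have hcont : ContinuousOn
      (fun x : ℝ => (((F (x + π * Complex.I)).im - π : ℝ) * Complex.I : ℂ))
      (Set.Ioi (max R S)) := by
    have h1 : ContinuousOn (fun x : ℝ => F (x + π * Complex.I)) (Set.Ioi (max R S)) := by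
      refine hR.comp (Continuous.continuousOn (by fun_prop)) fun x hx => ?_
      simpa using (le_max_left R S).trans_lt hx
    have h2 := Complex.continuous_im.comp_continuousOn h1
    exact (Complex.continuous_ofReal.comp_continuousOn (h2.sub continuousOn_const)).mul
      continuousOn_const
  have hb : max R S + 1 ∈ Set.Ioi (max R S) := by simp
  obtain ⟨n, hn⟩ := Complex.exp_eq_one_iff.1 (hexp _ hb)
  have hconst : ∀ x ∈ Set.Ioi (max R S), (F (x + π * Complex.I)).im = π + n * (2 * π) := by
    intro x hx
    have h1 := const_of_exp_eq_one isPreconnected_Ioi hcont hexp x hx _ hb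
    rw [hn, ← mul_assoc] at h1
    have h2 := mul_right_cancel₀ Complex.I_ne_zero h1
    have h3 : (F (x + π * Complex.I)).im - π = n * (2 * π) := by exact_mod_cast h2
    linarith
  -- Composing with the deck transformation `-n` brings the line back to height `π`.
  refine ⟨deck (Multiplicative.ofAdd (-n)) * φ, ?_, deckMap (-n) * F, ?_, ?_⟩
  · have := LiftGroup.mul_mem (eulerExtension.inl (Multiplicative.ofAdd (-n))).2 hφ
    have e : (eulerExtension.inl (Multiplicative.ofAdd (-n))).1 * (g, φ) =
        (g, deck (Multiplicative.ofAdd (-n)) * φ) := Prod.ext (one_mul g) rfl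
    rwa [e] at this
  · rw [Con.coe_mul, hF]; rfl
  · filter_upwards [eventually_gt_atTop (max R S)] with x hx
    rw [EndMap.mul_apply]
    simp only [deckMap]
    simp [hconst x hx]

/-- Lifts preserving the line `im w = π` of diffeomorphisms that commute near infinity commute. -/
lemma commutator_eq_one_of_preservesRay {g h : DiffeoPlus} {φ ψ : EndGermsˣ}
    (hφ : (g, φ) ∈ LiftGroup) (hψ : (h, ψ) ∈ LiftGroup) (rφ : PreservesRay (φ : EndGerms))
    (rψ : PreservesRay (ψ : EndGerms)) (e : ∀ᶠ z in cocompact ℂ, (⁅g, h⁆ : DiffeoPlus).1 z = z) :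
    ⁅φ, ψ⁆ = 1 := by
  have h1 : (⁅g, h⁆, ⁅φ, ψ⁆) ∈ LiftGroup := by
    have := (⁅(⟨_, hφ⟩ : LiftGroup), (⟨_, hψ⟩ : LiftGroup)⁆ : LiftGroup).2
    exact this
  -- The commutator is the identity near infinity downstairs, so upstairs it is some `deck n`.
  -- Comparing imaginary parts of `φ ψ` and `deck n * (ψ φ)` at one point far along the ray gives `π
  -- = π + 2πn`.
  obtain ⟨n, hn⟩ := covers_one_iff.1 (h1.1.congr (h := 1) e)
  have hn : ⁅φ, ψ⁆ = deck n := Units.ext hn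
  have h2 : φ * ψ = deck n * (ψ * φ) := by rw [← hn, commutatorElement_def]; group
  obtain ⟨F, hF, -⟩ := rφ.mul rψ
  obtain ⟨H, hH, -⟩ := rψ.mul rφ
  have h3 : (F : EndGerms) = (deckMap n.toAdd * H : EndMap) := by
    rw [hF, Con.coe_mul, hH, ← deck_val]
    exact congrArg Units.val h2
  have h4 : (F : ℂ → ℂ) =ᶠ[endFilter] (deckMap n.toAdd * H : EndMap) := (Con.eq germCon).1 h3
  obtain ⟨x, e1, e2, e3⟩ := ((tendsto_ray.eventually h4).and
    ((PreservesRay.eventually (hF ▸ rφ.mul rψ)).and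
      (PreservesRay.eventually (hH ▸ rψ.mul rφ)))).exists
  have h5 := congrArg Complex.im e1
  rw [e2, EndMap.mul_apply] at h5
  simp only [deckMap] at h5
  simp [e3, Real.pi_ne_zero] at h5
  rw [hn, ← ofAdd_toAdd n, h5]
  simp

/-! ## The theorem -/

/-- Diffeomorphisms satisfying the surface relation with Euler number `n`. -/
lemma exists_euler_number (n : ℤ) : ∃ a b c d : DiffeoPlus, ⁅a, b⁆ * ⁅c, d⁆ = 1 ∧
    surfaceSum (extCocycleFun eulerExtension eulerExtension.surjInvRightHom) a b c d = n := by
  set k : DiffeoPlus := ⁅doubling, logTwist n⁆⁻¹ with hk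
  have hK : ∀ z : ℂ, 2 ≤ ‖z‖ → k.1 z = z := fun z hz =>
    symm_apply_of_le (fun z hz => commutator_doubling_logTwist n hz) z hz
  set s := spread hK k.2.1 k.2.2.1
  have hs : ⁅s, translation 10⁆ = k := Subtype.ext (commutator_spread hK k.2.1 k.2.2.1)
  have hrel : ⁅doubling, logTwist n⁆ * ⁅s, translation 10⁆ = 1 := by rw [hs, hk, mul_inv_cancel]
  -- The copies of `k` extend only to the right, so `s` is the identity on `re z ≤ -3` and fixes the
  -- end of the negative axis pointwise.
  obtain ⟨φ, hφ, rφ⟩ := exists_preservesRay s (by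
    filter_upwards [eventually_ge_atTop 3] with x hx
    exact ⟨x, by linarith, spreadFun_of_re_le hK (by simpa using hx)⟩)
  obtain ⟨ψ, hψ, rψ⟩ := exists_preservesRay (translation 10) (by
    filter_upwards [eventually_gt_atTop 10] with x hx
    refine ⟨x - 10, by linarith, ?_⟩
    show (-x : ℂ) + 10 = _
    push_cast
    ring)
  have hcomm : ⁅φ, ψ⁆ = 1 := by
    refine commutator_eq_one_of_preservesRay hφ hψ rφ rψ ?_
    rw [hs]
    filter_upwards [tendsto_norm_cocompact_atTop.eventually (eventually_ge_atTop 2)] with z hz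
      using hK z hz
  refine ⟨doubling, logTwist n, s, translation 10, hrel, ?_⟩
  let σ := eulerExtension.surjInvRightHom
  let x₁ : LiftGroup := ⟨_, shiftUnit_mem⟩
  let y₁ : LiftGroup := ⟨_, rotationUnit_mem n⟩
  let x₂ : LiftGroup := ⟨_, hφ⟩
  let y₂ : LiftGroup := ⟨_, hψ⟩
  have h1 := inl_surfaceSum eulerExtension eulerExtension_central σ hrel
  -- The arbitrary section is traded for lifts that can be computed with: the shift and shear for
  -- the first handle, the ray-preserving lifts for the second.
  have h2 : ⁅σ doubling, σ (logTwist n)⁆ = ⁅x₁, y₁⁆ :=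
    commutator_section eulerExtension eulerExtension_central σ x₁ y₁
  have h3 : ⁅σ s, σ (translation 10)⁆ = ⁅x₂, y₂⁆ :=
    commutator_section eulerExtension eulerExtension_central σ x₂ y₂
  have h4 : ⁅x₁, y₁⁆ * ⁅x₂, y₂⁆ = eulerExtension.inl (Multiplicative.ofAdd n) := by
    refine Subtype.ext (Prod.ext hrel ?_)
    show ⁅shiftUnit (Real.log 2), rotationUnit (logAngle n)⁆ * ⁅φ, ψ⁆ =
      deck (Multiplicative.ofAdd n)
    rw [hcomm, mul_one, commutator_shiftUnit_rotationUnit]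
  rw [h2, h3, h4] at h1
  exact Multiplicative.ofAdd.injective (eulerExtension.inl_injective h1)

/-- A homomorphism from the surface group given by its values on the generators. -/
lemma SurfaceGroup.exists_hom {G : Type} [Group G] {a b c d : G} (h : ⁅a, b⁆ * ⁅c, d⁆ = 1) :
    ∃ ρ : SurfaceGroup →* G, ρ a₁ = a ∧ ρ b₁ = b ∧ ρ a₂ = c ∧ ρ b₂ = d := by
  have hr : ∀ r ∈ ({surfaceRel} : Set (FreeGroup (Fin 4))),
      FreeGroup.lift ![a, b, c, d] r = 1 := by
    rintro r rfl
    simpa [surfaceRel, map_commutatorElement] using h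
  exact ⟨PresentedGroup.toGroup hr, PresentedGroup.toGroup.of hr, PresentedGroup.toGroup.of hr,
    PresentedGroup.toGroup.of hr, PresentedGroup.toGroup.of hr⟩

lemma not_isBoundedClass_eulerClass : ¬ IsBoundedClass (toReal eulerClass) := by
  rintro ⟨f, hf, C, hC⟩
  obtain ⟨f', h1, h2⟩ := cohomologyMap_mk (MonoidHom.id DiffeoPlus) (Int.castAddHom ℝ)
    (extCocycle eulerExtension eulerExtension_central eulerExtension.surjInvRightHom)
  have h3 : groupCohomology.H2π _ f' = groupCohomology.H2π _ f := h1.symm.trans hf.symm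
  rw [groupCohomology.H2π_eq_iff] at h3
  obtain ⟨v, hv⟩ := h3
  -- The fundamental cycle has eight terms with coefficients `±1`, so an Euler number above `8 * C`
  -- contradicts the bound.
  obtain ⟨n, hn⟩ := exists_int_gt (8 * C)
  obtain ⟨a, b, c, d, hr, hs⟩ := exists_euler_number n
  have h4 : (f'.1 : DiffeoPlus × DiffeoPlus → ℝ) =
      (fun p => v p.2 - v (p.1 * p.2) + v p.1) + f.1 :=
    funext fun p => sub_eq_iff_eq_add.1 (congrFun hv p).symm
  have h5 : (f'.1 : DiffeoPlus × DiffeoPlus → ℝ) = fun p =>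
      ((extCocycleFun eulerExtension eulerExtension.surjInvRightHom p : ℤ) : ℝ) :=
    funext fun p => h2 p.1 p.2
  have h6 := surfaceSum_intCast
    (extCocycleFun eulerExtension eulerExtension.surjInvRightHom) a b c d
  rw [hs, ← h5, h4, surfaceSum_add, surfaceSum_coboundary v hr, zero_add] at h6
  have h7 := surfaceSum_le hC a b c d
  rw [h6] at h7
  linarith

end PlanarEuler

end

theorem theoremC :
    (∀ i : ℤ, ∃ ρ : PlanarEuler.SurfaceGroup →* PlanarEuler.DiffeoPlus,
      PlanarEuler.pairing (PlanarEuler.pullback ρ PlanarEuler.eulerClass)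
        PlanarEuler.SurfaceGroup.fundamentalClass = i) ∧
    ¬ PlanarEuler.IsBoundedClass (PlanarEuler.toReal PlanarEuler.eulerClass) := by
  refine ⟨fun i => ?_, PlanarEuler.not_isBoundedClass_eulerClass⟩
  obtain ⟨a, b, c, d, hr, hs⟩ := PlanarEuler.exists_euler_number i
  obtain ⟨ρ, rfl, rfl, rfl, rfl⟩ := PlanarEuler.SurfaceGroup.exists_hom hr
  refine ⟨ρ, ?_⟩
  rw [PlanarEuler.eulerClass, PlanarEuler.extClass, PlanarEuler.pairing_pullback]
  exact hs
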